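/- **Theorem (signed formula for unit interval graphs).** Let $G$ be a unit interval graph on $[n]=\{1,\dots,n\}$ with its natural labelling, i.e. there is a collection of intervals $[a,b]\subseteq[n]$ such that two distinct vertices $i,j$ are adjacent if and only if some interval of the collection contains both. In formal power series over $\mathbb{Q}$ in non-commuting variables $x_1,x_2,\dots$ let $$Y_G=\sum_{\kappa}x_{\kappa(1)}x_{\kappa(2)}\cdots x_{\kappa(n)},$$ summed over all proper colourings $\kappa:[n]\to\{1,2,\dots\}$ of $G$, and for a set partition $\pi$ of $[n]$ let $$e_\pi=\sum_{(i_1,\dots,i_n)}x_{i_1}\cdots x_{i_n},$$ summed over all tuples of positive integers with $i_j\ne i_k$ whenever $j\neq k$ lie in the same block of $\pi$. Write $\pi\sim\sigma$ if $\pi$ and $\sigma$ have the same multiset of block sizes and their blocks containing $n$ have equal size. For $f,g$ in the $\mathbb{Q}$-span of the basis $\{e_\pi\}_{\pi\vdash[n]}$ write $f\equiv_n g$ if, for every $\sim$-class, the sum of the coefficients of the $e_\pi$ with $\pi$ in that class is the same for $f$ and for $g$. Let $\mathcal{A}'_L(G)$ be the set of all objects $D'$ consisting of: * a set of arcs $(i,j)$,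 $i<j$, each an edge of $G$, such that every vertex $j$ has at most one left arc $(i,j)$; * a tic mark on some (possibly none, possibly all) of the arcs; the tic mark on an arc $(i,j)$ separates, in the connected component (with respect to the arcs) containing it, the vertices less than $j$ from the vertices greater than or equal to $j$, and so the tic marks split each connected component into pieces; * a permutation $\delta\in\mathfrak{S}_n$, $\delta(i)$ being the label of vertex $i$, such that the labels increase from left to right on each piece; * for each connected component, a star on exactly one vertex of the right-most piece of that component. Let $t(D')$ be the number of tic marks of $D'$ and $\pi(D')$ the set partition of $[n]$ whose blocks are the pieces of $D'$. Then $Y_G$ lies in the span of the $e_\pi$, $\pi\vdash[n]$, and $$Y_G\equiv_n\frac{1}{n!}\sum_{D'\in\mathcal{A}'_L(G)}(-1)^{t(D')}e_{\pi(D')}.$$ -/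

import Mathlib

namespace NCChrom

/-! ### Formal series in non-commuting variables -/

/-- Formal power series over `ℚ` in the non-commuting variables `x₁, x₂, …`, given by the
coefficient of each word in the variables. -/
abbrev NCSeries : Type := FreeMonoid ℕ+ → ℚ

/-- The word `x_{i 0} x_{i 1} ⋯ x_{i (n-1)}`. -/
def word {n : ℕ} (i : Fin n → ℕ+) : FreeMonoid ℕ+ :=
  FreeMonoid.ofList (List.ofFn i)

/-- The formal sum `∑_{i ∈ S} x_{i 0} ⋯ x_{i (n-1)}`: the coefficient of a word `w` is the number
of tuples in `S` that spell `w`. -/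
noncomputable def formalSum {n : ℕ} (S : Set (Fin n → ℕ+)) : NCSeries :=
  fun w => ({i | i ∈ S ∧ word i = w}.ncard : ℚ)

/-! ### Set partitions and elementary symmetric functions

The set `[n]` is modelled by `Fin n`; the element `k` of `[n]` is the element of `Fin n` with value
`k - 1`. -/

/-- Set partitions of `[n]`. -/
abbrev SetPartition (n : ℕ) : Type := Finpartition (Finset.univ : Finset (Fin n))

/-- The elementary symmetric function `e_π` in non-commuting variables. -/
noncomputable def elem {n : ℕ} (π : SetPartition n) : NCSeries :=
  formalSum {i | ∀ B ∈ π.parts, ∀ j ∈ B, ∀ k ∈ B, j ≠ k → i j ≠ i k}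

/-- The multiset of block sizes of `π` (the integer partition `λ(π)`). -/
def shape {n : ℕ} (π : SetPartition n) : Multiset ℕ :=
  π.parts.val.map Finset.card

/-- `π ∼ σ`: same block sizes, and the blocks containing the last element `n` have equal size. -/
def Sim {n : ℕ} (π σ : SetPartition n) : Prop :=
  shape π = shape σ ∧
    ∀ A ∈ π.parts, ∀ B ∈ σ.parts, ∀ v : Fin n, v.val + 1 = n → v ∈ A → v ∈ B → A.card = B.card

open Classical in
/-- `f ≡ₙ g`: both `f` and `g` are linear combinations of the `e_π`, `π ⊢ [n]`, and over each
equivalence class of `∼` their coefficients have the same sum. -/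
def SemiEquiv (n : ℕ) (f g : NCSeries) : Prop :=
  f ∈ Submodule.span ℚ (Set.range (elem (n := n))) ∧
  g ∈ Submodule.span ℚ (Set.range (elem (n := n))) ∧
  ∀ c d : SetPartition n → ℚ,
    f = ∑ π, c π • elem π → g = ∑ π, d π • elem π →
    ∀ π : SetPartition n,
      ∑ σ with Sim σ π, c σ = ∑ σ with Sim σ π, d σ

/-! ### Graphs -/

/-- `G` is the unit interval graph on `[n]` formed by some collection `S` of intervals `[a, b]`,
`a ≤ b`: two distinct vertices are adjacent iff some interval of `S` contains both. -/
def IsUnitInterval {n : ℕ} (G : SimpleGraph (Fin n)) : Prop :=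
  ∃ S : Set (Fin n × Fin n), (∀ p ∈ S, p.1 ≤ p.2) ∧
    ∀ i j, G.Adj i j ↔ i ≠ j ∧ ∃ p ∈ S, i ∈ Set.Icc p.1 p.2 ∧ j ∈ Set.Icc p.1 p.2

/-- The chromatic symmetric function `Y_G` in non-commuting variables: the sum over all proper
colourings `κ` of `x_{κ(1)} ⋯ x_{κ(n)}`. -/
noncomputable def chromY {n : ℕ} (G : SimpleGraph (Fin n)) : NCSeries :=
  formalSum {κ | ∀ u v, G.Adj u v → κ u ≠ κ v}

/-! ### Arc diagrams -/

/-- Arc diagrams of `G`: sets of arcs `(i, j)`, `i < j`, each an edge of `G`, such that every vertex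
`j` has at most one left arc `(i, j)`. -/
@[ext]
structure ArcDiagram {n : ℕ} (G : SimpleGraph (Fin n)) where
  arcs : Finset (Fin n × Fin n)
  arcs_lt : ∀ a ∈ arcs, a.1 < a.2
  arcs_adj : ∀ a ∈ arcs, G.Adj a.1 a.2
  left_unique : ∀ a ∈ arcs, ∀ b ∈ arcs, a.2 = b.2 → a = b

/-- Two vertices lie in the same connected component of the arc diagram. -/
def ArcDiagram.Conn {n : ℕ} {G : SimpleGraph (Fin n)} (D : ArcDiagram G) (u v : Fin n) : Prop :=
  (SimpleGraph.fromRel fun i j => (i, j) ∈ D.arcs).Reachable u v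

/-- Arc diagrams of `G` some of whose arcs are decorated with a tic mark. -/
@[ext]
structure TicDiagram {n : ℕ} (G : SimpleGraph (Fin n)) extends ArcDiagram G where
  tics : Finset (Fin n × Fin n)
  tics_subset : tics ⊆ arcs

namespace TicDiagram

variable {n : ℕ} {G : SimpleGraph (Fin n)}

/-- Two vertices lie in the same piece: they are in the same connected component, and no tic mark on
an arc `(i, j)` of that component separates them, where such a tic mark separates the vertices of
the component left of `j` from `j` and the vertices right of `j`. -/
def SamePiece (D : TicDiagram G) (u v : Fin n) : Prop :=
  D.Conn u v ∧ ∀ a ∈ D.tics, D.Conn a.2 u → (u < a.2 ↔ v < a.2)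

/-- The partition of the vertices into pieces, as an equivalence relation. -/
def pieceSetoid (D : TicDiagram G) : Setoid (Fin n) where
  r := D.SamePiece
  iseqv :=
    { refl := fun u => ⟨SimpleGraph.Reachable.refl u, fun _ _ _ => Iff.rfl⟩
      symm := fun {_ _} h => ⟨h.1.symm, fun a ha hc => (h.2 a ha (hc.trans h.1.symm)).symm⟩
      trans := fun {_ _ _} h k => ⟨h.1.trans k.1, fun a ha hc =>
        (h.2 a ha hc).trans (k.2 a ha (hc.trans h.1))⟩ }

open Classical in
/-- The set partition `π(D')` of `[n]` into pieces. -/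
noncomputable def partition (D : TicDiagram G) : SetPartition n :=
  Finpartition.ofSetoid D.pieceSetoid

/-- The vertex `u` lies in the right-most piece of its connected component: the vertices of the
component in other pieces are all to the left of `u`. -/
def InRightmostPiece (D : TicDiagram G) (u : Fin n) : Prop :=
  ∀ v, D.Conn u v → ¬ D.SamePiece u v → v < u

end TicDiagram

/-- Arc diagrams of `G` with tic marks, a permutation labelling the vertices which is increasing on
each piece, and, in each connected component, exactly one star, which is on a vertex of the
right-most piece of that component. -/
@[ext]
structure LabeledDiagram {n : ℕ} (G : SimpleGraph (Fin n)) extends TicDiagram G where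
  label : Equiv.Perm (Fin n)
  label_increasing : ∀ u v, toTicDiagram.SamePiece u v → u < v → label u < label v
  stars : Finset (Fin n)
  stars_rightmost : ∀ u ∈ stars, toTicDiagram.InRightmostPiece u
  stars_unique : ∀ v, ∃! u, u ∈ stars ∧ toArcDiagram.Conn v u

instance {n : ℕ} (G : SimpleGraph (Fin n)) : Finite (LabeledDiagram G) :=
  Finite.of_injective (fun D => (D.arcs, D.tics, D.label, D.stars)) (by
    intro D E h
    simp only [Prod.mk.injEq] at h
    exact LabeledDiagram.ext h.1 h.2.1 h.2.2.1 h.2.2.2)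

noncomputable instance {n : ℕ} (G : SimpleGraph (Fin n)) : Fintype (LabeledDiagram G) :=
  Fintype.ofFinite _

/-- The number `t(D')` of tic marks. -/
def TicDiagram.numTics {n : ℕ} {G : SimpleGraph (Fin n)} (D : TicDiagram G) : ℕ :=
  D.tics.card

end NCChrom

/-! In a unit interval graph the left neighbours of a vertex j form a clique. A colouring that is
proper before j therefore gives the colour of j to at most one of them, and ∏_j (1 - ∑_{i<j, i~j} [κ
i = κ j]) is the indicator of the proper colourings. Expanding it chooses at most one left arc at
each vertex, so Y_G is the sum over arc diagrams of the product over components C of (-1)^(|C|-1)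
p_C, where p_C is the indicator of being constant on C (`chromY_eq_toSeries`).

Permuting positions while fixing n permutes the e_π inside each ∼-class, and the e_π are linearly
independent. So f ≡ₙ g as soon as f and g have the same sum of translates under these permutations
(`semiEquiv_toSeries`).

Each factor (-1)^(|C|-1) p_C is then traded for `cutSum C` (`symmetrize_mul_cutSum`). Take Newton's
identity, expanding e_C over subsets B of C \ {m} with terms e_B p_{C \ B}, where m is the largest
element of C. The allowed permutations can move B to the initial segment of C of the same size.
Solving the resulting recursion for p_C yields a signed sum over all ways to cut C into consecutive
pieces, weighted by ∏ 1/|B|! and by the size of the last piece.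

These weights are the counts in the theorem: n!/∏|B|! labellings increase on the pieces, and each
component has as many star positions as its last piece has vertices (`sum_labeledDiagram_elemFun`).
-/

namespace NCChrom

/-! ### Newton's identity in non-commuting variables -/

section Newton

variable {V K : Type*}

open Classical in
/-- Indicator of the colourings which are injective on `B`. -/
noncomputable def injInd (B : Finset V) (κ : V → K) : ℚ :=
  if Set.InjOn κ B then 1 else 0

open Classical in
/-- Indicator of the colourings which are constant on `B`. -/
noncomputable def constInd (B : Finset V) (κ : V → K) : ℚ :=
  if ∀ u ∈ B, ∀ v ∈ B, κ u = κ v then 1 else 0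

/-- `(-1)^(|S|-1) (|S|-1)!` times the indicator of the colourings constant on `S`. -/
noncomputable def scaledConst (S : Finset V) (κ : V → K) : ℚ :=
  (-1) ^ (S.card - 1) * (S.card - 1).factorial * constInd S κ

lemma injInd_congr {B : Finset V} {κ κ' : V → K} (h : ∀ v ∈ B, κ v = κ' v) :
    injInd B κ = injInd B κ' := by
  have : Set.InjOn κ B ↔ Set.InjOn κ' B := Set.EqOn.injOn_iff (fun v hv => h v hv)
  classical exact if_congr this rfl rfl

lemma constInd_congr {B : Finset V} {κ κ' : V → K} (h : ∀ v ∈ B, κ v = κ' v) :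
    constInd B κ = constInd B κ' := by
  have : (∀ u ∈ B, ∀ v ∈ B, κ u = κ v) ↔ (∀ u ∈ B, ∀ v ∈ B, κ' u = κ' v) :=
    forall₂_congr fun u hu => forall₂_congr fun v hv => by rw [h u hu, h v hv]
  classical exact if_congr this rfl rfl

@[simp] lemma injInd_empty (κ : V → K) : injInd ∅ κ = 1 := by simp [injInd]

lemma constInd_eq_one_iff {B : Finset V} {κ : V → K} {m : V} (hm : m ∈ B) :
    constInd B κ = 1 ↔ ∀ u ∈ B, κ u = κ m := by
  rw [constInd]
  split_ifs with h
  · exact ⟨fun _ u hu => h u hu m hm, fun _ => rfl⟩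
  · refine ⟨fun h' => by simp at h', fun h' => absurd (fun u hu v hv => ?_) h⟩
    rw [h' u hu, h' v hv]

lemma constInd_eq_zero_or_one (B : Finset V) (κ : V → K) :
    constInd B κ = 0 ∨ constInd B κ = 1 := by
  rw [constInd]; split_ifs <;> simp

variable [DecidableEq V]

lemma injInd_image (τ : Equiv.Perm V) (B : Finset V) (κ : V → K) :
    injInd (B.image τ) κ = injInd B (κ ∘ τ) := by
  have : Set.InjOn κ (B.image τ) ↔ Set.InjOn (κ ∘ τ) B := by
    rw [Finset.coe_image]
    exact (Set.InjOn.comp_iff τ.injective.injOn).symm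
  classical exact if_congr this rfl rfl

lemma constInd_image (τ : Equiv.Perm V) (B : Finset V) (κ : V → K) :
    constInd (B.image τ) κ = constInd B (κ ∘ τ) := by
  classical exact if_congr (by simp) rfl rfl

/-- Newton's identity in non-commuting variables. -/
theorem newton_identity (C : Finset V) {m : V} (hm : m ∈ C) (κ : V → K) :
    ∑ B ∈ (C.erase m).powerset, injInd B κ * scaledConst (C \ B) κ = injInd C κ := by
  classical
  set N := C.filter (fun v => κ v ≠ κ m) with hN
  set M := (C.filter (fun v => κ v = κ m)).erase m with hM
  have hNC : N ⊆ C.erase m := fun v hv => by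
    rw [hN, Finset.mem_filter] at hv
    exact Finset.mem_erase.2 ⟨fun h => hv.2 (by rw [h]), hv.1⟩
  have hsub : insert N (M.image fun x => insert x N) ⊆ (C.erase m).powerset := by
    intro B hB
    rw [Finset.mem_insert, Finset.mem_image] at hB
    rw [Finset.mem_powerset]
    rcases hB with rfl | ⟨x, hx, rfl⟩
    · exact hNC
    · refine Finset.insert_subset ?_ hNC
      simp only [hM, Finset.mem_erase, Finset.mem_filter] at hx
      exact Finset.mem_erase.2 ⟨hx.1, hx.2.1⟩
  have hsplit : C = N ∪ insert m M := by
    ext v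
    simp only [hN, hM, Finset.mem_union, Finset.mem_filter, Finset.mem_insert, Finset.mem_erase]
    by_cases h : v = m
    · subst h; simp [hm]
    · simp only [h]; tauto
  have hmM : m ∉ M := by simp [hM]
  have hdis : Disjoint N (insert m M) := by
    rw [Finset.disjoint_left]
    intro v hv hv'
    simp only [hN, hM, Finset.mem_filter, Finset.mem_insert, Finset.mem_erase] at hv hv'
    rcases hv' with rfl | hv'
    · exact hv.2 rfl
    · exact hv.2 hv'.2.2
  have hcol : ∀ v ∈ insert m M, κ v = κ m := by
    intro v hv
    simp only [hM, Finset.mem_insert, Finset.mem_erase, Finset.mem_filter] at hv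
    rcases hv with rfl | hv
    · rfl
    · exact hv.2.2
  -- In a nonzero term C \ B is monochromatic and contains m, so B contains N. As B is rainbow, it
  -- has at most one further element, taken from M.
  have hzero : ∀ B ∈ (C.erase m).powerset, B ∉ insert N (M.image fun x => insert x N) →
      injInd B κ * scaledConst (C \ B) κ = 0 := by
    intro B hB hB'
    rw [Finset.mem_powerset] at hB
    have hmB : m ∈ C \ B := Finset.mem_sdiff.2 ⟨hm, fun h => by simpa using hB h⟩
    by_contra hne
    have h1 : Set.InjOn κ B := by
      by_contra h; exact hne (by simp [injInd, h])
    have h2 : constInd (C \ B) κ = 1 := by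
      rcases constInd_eq_zero_or_one (C \ B) κ with h | h
      · exact absurd (by simp [scaledConst, h]) hne
      · exact h
    rw [constInd_eq_one_iff hmB] at h2
    have hNB : N ⊆ B := fun v hv => by
      by_contra hvB
      rw [hN, Finset.mem_filter] at hv
      exact hv.2 (h2 v (Finset.mem_sdiff.2 ⟨hv.1, hvB⟩))
    apply hB'
    rw [Finset.mem_insert, Finset.mem_image]
    by_cases hBN : B ⊆ N
    · exact Or.inl (Finset.Subset.antisymm hBN hNB)
    · right
      obtain ⟨x, hxB, hxN⟩ := Finset.not_subset.1 hBN
      have hxC := Finset.mem_erase.1 (hB hxB)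
      have hx : κ x = κ m := by
        by_contra h
        exact hxN (Finset.mem_filter.2 ⟨hxC.2, h⟩)
      refine ⟨x, Finset.mem_erase.2 ⟨hxC.1, Finset.mem_filter.2 ⟨hxC.2, hx⟩⟩, ?_⟩
      refine Finset.Subset.antisymm (Finset.insert_subset hxB hNB) fun y hy => ?_
      rw [Finset.mem_insert]
      by_cases hyN : y ∈ N
      · exact Or.inr hyN
      · left
        have hyC := Finset.mem_erase.1 (hB hy)
        have hy' : κ y = κ m := by
          by_contra h
          exact hyN (Finset.mem_filter.2 ⟨hyC.2, h⟩)
        exact h1 hy hxB (hy'.trans hx.symm)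
  rw [← Finset.sum_subset hsub hzero]
  have hMN : ∀ x ∈ M, x ∉ N := fun x hx hx' =>
    Finset.disjoint_left.1 hdis hx' (Finset.mem_insert_of_mem hx)
  have hnot : N ∉ M.image fun x => insert x N := by
    intro h
    obtain ⟨x, hx, hxN⟩ := Finset.mem_image.1 h
    exact hMN x hx (hxN ▸ Finset.mem_insert_self x N)
  have hinj : Set.InjOn (fun x => insert x N) (M : Set V) := by
    intro x hx y hy hxy
    have : x ∈ insert y N := by
      have := Finset.mem_insert_self x N
      rwa [show insert x N = insert y N from hxy] at this
    rcases Finset.mem_insert.1 this with h | h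
    · exact h
    · exact absurd h (hMN x hx)
  rw [Finset.sum_insert hnot, Finset.sum_image hinj]
  have hCN : C \ N = insert m M := by
    rw [hsplit, Finset.union_sdiff_left]
    exact Finset.sdiff_eq_self_of_disjoint hdis.symm
  have hq : scaledConst (C \ N) κ = (-1) ^ M.card * M.card.factorial := by
    rw [hCN, scaledConst, (constInd_eq_one_iff (Finset.mem_insert_self m M)).2 hcol,
      Finset.card_insert_of_notMem hmM]
    simp
  have hqx : ∀ x ∈ M, injInd (insert x N) κ * scaledConst (C \ insert x N) κ =
      injInd N κ * ((-1) ^ (M.card - 1) * (M.card - 1).factorial) := by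
    intro x hx
    have hxm : x ≠ m := fun h => hmM (h ▸ hx)
    have e1 : C \ insert x N = insert m (M.erase x) := by
      rw [← Finset.erase_insert_of_ne hxm.symm, ← hCN]
      ext v
      simp only [Finset.mem_sdiff, Finset.mem_insert, Finset.mem_erase]
      tauto
    have e2 : injInd (insert x N) κ = injInd N κ := by
      have : Set.InjOn κ (insert x N : Finset V) ↔ Set.InjOn κ N := by
        rw [Finset.coe_insert, Set.injOn_insert (by exact_mod_cast hMN x hx)]
        refine and_iff_left ?_
        rintro ⟨y, hy, hyx⟩
        have : y ∈ N := hy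
        rw [hN, Finset.mem_filter] at this
        exact this.2 (hyx.trans (hcol x (Finset.mem_insert_of_mem hx)))
      exact if_congr this rfl rfl
    have e3 : constInd (insert m (M.erase x)) κ = 1 := by
      refine (constInd_eq_one_iff (Finset.mem_insert_self _ _)).2 fun u hu => hcol u ?_
      exact Finset.insert_subset_insert _ (Finset.erase_subset _ _) hu
    rw [e1, e2, scaledConst, e3, Finset.card_insert_of_notMem (fun h => hmM (Finset.mem_of_mem_erase h)),
      Finset.card_erase_of_mem hx]
    simp
  -- The term B = N carries (-1)^|M| |M|!, and the |M| terms B = N ∪ {x} each carry (-1)^(|M|-1)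
  -- (|M|-1)!. They cancel unless M is empty, when only B = N is left.
  rw [Finset.sum_congr rfl hqx, Finset.sum_const, hq]
  by_cases hM0 : M = ∅
  · have : injInd C κ = injInd N κ := by
      have : Set.InjOn κ C ↔ Set.InjOn κ N := by
        have hC : C = insert m N := by
          rw [hsplit, hM0, Finset.union_comm, insert_empty_eq, ← Finset.insert_eq]
        rw [hC, Finset.coe_insert, Set.injOn_insert (by simp [hN])]
        refine and_iff_left ?_
        rintro ⟨y, hy, hyx⟩
        have : y ∈ N := hy
        rw [hN, Finset.mem_filter] at this
        exact this.2 hyx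
      exact if_congr this rfl rfl
    simp [hM0, this]
  · obtain ⟨x, hx⟩ := Finset.nonempty_iff_ne_empty.2 hM0
    have : injInd C κ = 0 := by
      rw [injInd, if_neg]
      intro h
      have hxC : x ∈ C := by rw [hsplit]; simp [hx]
      have := h hxC hm (hcol x (Finset.mem_insert_of_mem hx))
      exact hmM (this ▸ hx)
    rw [this]
    obtain ⟨k, hk⟩ : ∃ k, M.card = k + 1 :=
      Nat.exists_eq_succ_of_ne_zero (Finset.card_ne_zero_of_mem hx)
    rw [hk, Nat.factorial_succ]
    push_cast
    simp only [nsmul_eq_mul]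
    push_cast
    ring

end Newton

/-! ### Power sums lie in the span of the elementary functions -/

section Span

variable {V K : Type*}

lemma scaledConst_eq_smul (S : Finset V) :
    scaledConst (K := K) S =
      ((-1 : ℚ) ^ (S.card - 1) * (S.card - 1).factorial) • constInd S := by
  ext κ; simp [scaledConst]

variable [DecidableEq V]

/-- The span of the functions `∏_{B ∈ P} injInd B`, where `P` is a set partition of `X`. -/
def spanInj (K : Type*) (X : Finset V) : Submodule ℚ ((V → K) → ℚ) :=
  Submodule.span ℚ (Set.range fun P : Finpartition X => ∏ B ∈ P.parts, injInd B)

/-- The union of set partitions of two disjoint sets. -/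
def unionPartition {X Y : Finset V} (h : Disjoint X Y) (P : Finpartition X) (Q : Finpartition Y) :
    Finpartition (X ∪ Y) where
  parts := P.parts ∪ Q.parts
  supIndep := by
    rw [Finset.supIndep_iff_pairwiseDisjoint, Finset.coe_union,
      Set.pairwiseDisjoint_union]
    exact ⟨P.disjoint, Q.disjoint, fun A hA B hB _ =>
      Finset.disjoint_of_subset_left (P.subset hA) (Finset.disjoint_of_subset_right (Q.subset hB) h)⟩
  sup_parts := by rw [Finset.sup_union, P.sup_parts, Q.sup_parts]; rfl
  bot_notMem := by
    rw [Finset.mem_union]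
    exact not_or.2 ⟨P.bot_notMem, Q.bot_notMem⟩

lemma mul_mem_spanInj {X Y : Finset V} (h : Disjoint X Y) {f g : (V → K) → ℚ}
    (hf : f ∈ spanInj K X) (hg : g ∈ spanInj K Y) : f * g ∈ spanInj K (X ∪ Y) := by
  have hle : spanInj K X * spanInj K Y ≤ spanInj K (X ∪ Y) := by
    rw [spanInj, spanInj, Submodule.span_mul_span, Submodule.span_le]
    rintro _ ⟨_, ⟨P, rfl⟩, _, ⟨Q, rfl⟩, rfl⟩
    refine Submodule.subset_span ⟨unionPartition h P Q, ?_⟩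
    have hd : Disjoint P.parts Q.parts := by
      rw [Finset.disjoint_left]
      intro A hA hA'
      obtain ⟨v, hv⟩ := P.nonempty_of_mem_parts hA
      exact Finset.disjoint_left.1 h (P.subset hA hv) (Q.subset hA' hv)
    exact Finset.prod_union hd
  exact hle (Submodule.mul_mem_mul hf hg)

lemma injInd_mem_spanInj {B : Finset V} (hB : B.Nonempty) : injInd (K := K) B ∈ spanInj K B :=
  Submodule.subset_span ⟨Finpartition.indiscrete hB.ne_empty, by simp [Finpartition.indiscrete]⟩

/-- Newton's identity is solved for its term B = ∅; the other terms involve only the smaller sets C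
\ B. -/
lemma scaledConst_mem_spanInj (C : Finset V) (hC : C.Nonempty) :
    scaledConst (K := K) C ∈ spanInj K C := by
  induction C using Finset.strongInduction with
  | H C ih =>
    obtain ⟨m, hm⟩ := hC
    have hN : scaledConst (K := K) C = injInd C -
        ∑ B ∈ (C.erase m).powerset.erase ∅, injInd B * scaledConst (C \ B) := by
      ext κ
      have := newton_identity C hm κ
      rw [← Finset.add_sum_erase _ _ (Finset.empty_mem_powerset (C.erase m))] at this
      simp only [Pi.sub_apply, Finset.sum_apply, Pi.mul_apply]
      rw [← this]
      simp
    rw [hN]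
    refine Submodule.sub_mem _ (injInd_mem_spanInj ⟨m, hm⟩) (Submodule.sum_mem _ fun B hB => ?_)
    rw [Finset.mem_erase, Finset.mem_powerset] at hB
    have hBC : B ⊆ C := hB.2.trans (Finset.erase_subset _ _)
    have hmB : m ∈ C \ B := Finset.mem_sdiff.2 ⟨hm, fun h => by simpa using hB.2 h⟩
    have hne : B.Nonempty := Finset.nonempty_iff_ne_empty.2 hB.1
    have := mul_mem_spanInj (K := K) Finset.disjoint_sdiff (injInd_mem_spanInj hne)
      (ih (C \ B) (Finset.sdiff_ssubset hBC hne) ⟨m, hmB⟩)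
    rwa [Finset.union_sdiff_of_subset hBC] at this

lemma constInd_mem_spanInj (C : Finset V) (hC : C.Nonempty) :
    constInd (K := K) C ∈ spanInj K C := by
  have h := scaledConst_mem_spanInj (K := K) C hC
  rw [scaledConst_eq_smul] at h
  refine (Submodule.smul_mem_iff _ ?_).1 h
  have := Nat.factorial_ne_zero (C.card - 1)
  positivity

lemma prod_constInd_mem_spanInj {X : Finset V} (P : Finpartition X) :
    ∏ C ∈ P.parts, constInd (K := K) C ∈ spanInj K X := by
  suffices h : ∀ s ⊆ P.parts, ∏ C ∈ s, constInd (K := K) C ∈ spanInj K (s.sup id) by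
    have := h _ (subset_refl _)
    rwa [P.sup_parts] at this
  intro s
  induction s using Finset.induction_on with
  | empty =>
    intro _
    rw [Finset.sup_empty]
    exact Submodule.subset_span ⟨Finpartition.empty _, by simp⟩
  | insert C s hC ih =>
    intro hs
    rw [Finset.prod_insert hC, Finset.sup_insert]
    refine mul_mem_spanInj ?_ (constInd_mem_spanInj C (P.nonempty_of_mem_parts (hs (by simp))))
      (ih ((Finset.subset_insert _ _).trans hs))
    rw [Finset.disjoint_sup_right]
    intro B hB
    exact P.disjoint (hs (by simp)) (hs (Finset.mem_insert_of_mem hB)) (fun h => hC (h ▸ hB))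

end Span

/-! ### Linear independence of the e_π -/

section Independence

variable {n : ℕ}

/-- The function on colourings underlying `e_π`. -/
noncomputable def elemFun (π : SetPartition n) : (Fin n → ℕ+) → ℚ :=
  ∏ B ∈ π.parts, injInd B

/-- The function on colourings underlying the power sum `p_π`. -/
noncomputable def powFun (π : SetPartition n) : (Fin n → ℕ+) → ℚ :=
  ∏ B ∈ π.parts, constInd B

lemma prod_constInd_apply {V K : Type*} (s : Finset (Finset V)) (κ : V → K) [Decidable
    (∀ B ∈ s, ∀ u ∈ B, ∀ v ∈ B, κ u = κ v)] :
    ∏ B ∈ s, constInd B κ = if ∀ B ∈ s, ∀ u ∈ B, ∀ v ∈ B, κ u = κ v then 1 else 0 := by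
  classical
  simp only [constInd]
  rw [Finset.prod_ite_zero]
  simp

lemma prod_injInd_apply {V K : Type*} (s : Finset (Finset V)) (κ : V → K) [Decidable
    (∀ B ∈ s, Set.InjOn κ B)] :
    ∏ B ∈ s, injInd B κ = if ∀ B ∈ s, Set.InjOn κ B then 1 else 0 := by
  classical
  simp only [injInd]
  rw [Finset.prod_ite_zero]
  simp

/-- A colouring whose colour classes are the blocks of `σ`. -/
noncomputable def blockColouring (σ : SetPartition n) : Fin n → ℕ+ :=
  fun u => Nat.succPNat (Encodable.encode (σ.part u))

lemma blockColouring_eq_iff (σ : SetPartition n) (u v : Fin n) :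
    blockColouring σ u = blockColouring σ v ↔ σ.part u = σ.part v := by
  simp [blockColouring]

-- Evaluation at block colourings gives the zeta matrix of the refinement order, which is
-- unitriangular; this is what makes the p_π independent.
open Classical in
lemma powFun_blockColouring (π σ : SetPartition n) :
    powFun π (blockColouring σ) = if π ≤ σ then 1 else 0 := by
  rw [powFun, Finset.prod_apply, prod_constInd_apply]
  refine if_congr ?_ rfl rfl
  simp only [blockColouring_eq_iff]
  constructor
  · intro h B hB
    obtain ⟨u, hu⟩ := π.nonempty_of_mem_parts hB
    refine ⟨σ.part u, σ.part_mem.2 (Finset.mem_univ u), fun v hv => ?_⟩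
    rw [σ.mem_part_iff_part_eq_part (Finset.mem_univ _) (Finset.mem_univ _)]
    exact h B hB v hv u hu
  · intro h B hB u hu v hv
    obtain ⟨A, hA, hBA⟩ := h hB
    rw [σ.part_eq_of_mem hA (hBA hu), σ.part_eq_of_mem hA (hBA hv)]

lemma linearIndependent_powFun : LinearIndependent ℚ (powFun (n := n)) := by
  classical
  rw [Fintype.linearIndependent_iff]
  intro c hc σ
  induction σ using WellFoundedLT.induction with
  | ind σ ih =>
    have h := congrFun hc (blockColouring σ)
    simp only [Finset.sum_apply, Pi.smul_apply, powFun_blockColouring, smul_eq_mul,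
      Pi.zero_apply] at h
    rw [Finset.sum_eq_single σ] at h
    · simpa using h
    · intro π _ hπ
      by_cases hle : π ≤ σ
      · rw [ih π (lt_of_le_of_ne hle hπ), zero_mul]
      · simp [hle]
    · simp

lemma powFun_mem_span (π : SetPartition n) :
    powFun π ∈ Submodule.span ℚ (Set.range (elemFun (n := n))) :=
  prod_constInd_mem_spanInj π

/-- Dimension count: the span of the e_π contains the independent p_π, and both families are indexed
by the set partitions. -/
lemma linearIndependent_elemFun : LinearIndependent ℚ (elemFun (n := n)) := by
  rw [linearIndependent_iff_card_le_finrank_span]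
  rw [← finrank_span_eq_card (linearIndependent_powFun (n := n))]
  have := FiniteDimensional.span_of_finite ℚ (Set.finite_range (elemFun (n := n)))
  refine Submodule.finrank_mono ?_
  rw [Submodule.span_le]
  rintro _ ⟨π, rfl⟩
  exact powFun_mem_span π

end Independence

/-! ### From functions on colourings to formal series -/

section Series

variable {n : ℕ}

lemma word_injective : Function.Injective (word (n := n)) := fun _ _ h =>
  List.ofFn_injective (FreeMonoid.ofList.injective h)

/-- The series `∑_i F(i) x_{i 0} ⋯ x_{i (n-1)}`. -/
noncomputable def toSeries (n : ℕ) : ((Fin n → ℕ+) → ℚ) →ₗ[ℚ] NCSeries :=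
  Function.ExtendByZero.linearMap ℚ word

lemma toSeries_word (F : (Fin n → ℕ+) → ℚ) (κ : Fin n → ℕ+) : toSeries n F (word κ) = F κ :=
  word_injective.extend_apply _ _ _

lemma toSeries_injective : Function.Injective (toSeries n) := fun F F' h => by
  ext κ
  rw [← toSeries_word F, h, toSeries_word]

open Classical in
lemma formalSum_eq_toSeries (S : Set (Fin n → ℕ+)) :
    formalSum S = toSeries n (fun κ => if κ ∈ S then 1 else 0) := by
  ext w
  by_cases hw : ∃ κ : Fin n → ℕ+, word κ = w
  · obtain ⟨κ, rfl⟩ := hw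
    rw [toSeries_word, formalSum]
    have : {i | i ∈ S ∧ word i = word κ} = if κ ∈ S then {κ} else ∅ := by
      ext i
      simp only [word_injective.eq_iff]
      split_ifs with h
      · simp only [Set.mem_ofPred_eq, Set.mem_singleton_iff]
        exact ⟨fun h => h.2, fun h' => ⟨h' ▸ h, h'⟩⟩
      · simp only [Set.mem_ofPred_eq, Set.mem_empty_iff_false, iff_false]
        rintro ⟨h1, rfl⟩
        exact h h1
    rw [this]
    split_ifs <;> simp
  · rw [toSeries, Function.ExtendByZero.linearMap_apply, Function.extend_apply' _ _ _ hw, formalSum]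
    have : {i | i ∈ S ∧ word i = w} = ∅ := by
      ext i
      simp only [Set.mem_ofPred_eq, Set.mem_empty_iff_false, iff_false]
      exact fun h => hw ⟨i, h.2⟩
    rw [this]
    simp

lemma elem_eq_toSeries (π : SetPartition n) : elem π = toSeries n (elemFun π) := by
  classical
  rw [elem, formalSum_eq_toSeries]
  congr 1
  ext κ
  rw [elemFun, Finset.prod_apply, prod_injInd_apply]
  have hiff : κ ∈ {i : Fin n → ℕ+ | ∀ B ∈ π.parts, ∀ j ∈ B, ∀ k ∈ B, j ≠ k → i j ≠ i k} ↔
      ∀ B ∈ π.parts, Set.InjOn κ B := by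
    refine forall₂_congr fun B _ => ?_
    exact ⟨fun h j hj k hk hjk => by_contra fun hne => h j hj k hk hne hjk,
      fun h j hj k hk hne hjk => hne (h hj hk hjk)⟩
  by_cases h : ∀ B ∈ π.parts, Set.InjOn κ B
  · rw [if_pos h, if_pos (hiff.2 h)]
  · rw [if_neg h, if_neg (mt hiff.1 h)]

end Series

/-! ### Symmetrization over permutations fixing the last element -/

section Transfer

variable {n : ℕ}

/-- The permutations of `[n]` fixing the last element. -/
def FixesLast (τ : Equiv.Perm (Fin n)) : Prop := ∀ v : Fin n, v.val + 1 = n → τ v = v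

open Classical in
/-- The sum of the translates of a function on colourings by the permutations fixing the last
element. -/
noncomputable def symmetrize (n : ℕ) : ((Fin n → ℕ+) → ℚ) →ₗ[ℚ] ((Fin n → ℕ+) → ℚ) :=
  ∑ τ : Equiv.Perm (Fin n) with FixesLast τ, LinearMap.funLeft ℚ ℚ fun κ => κ ∘ τ

open Classical in
lemma symmetrize_apply (F : (Fin n → ℕ+) → ℚ) (κ : Fin n → ℕ+) :
    symmetrize n F κ = ∑ τ : Equiv.Perm (Fin n) with FixesLast τ, F (κ ∘ τ) := by
  simp [symmetrize, LinearMap.sum_apply, Finset.sum_apply, LinearMap.funLeft_apply]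

lemma symmetrize_comp (F : (Fin n → ℕ+) → ℚ) {ρ : Equiv.Perm (Fin n)} (hρ : FixesLast ρ) :
    symmetrize n (fun κ => F (κ ∘ ρ)) = symmetrize n F := by
  classical
  ext κ
  rw [symmetrize_apply, symmetrize_apply]
  refine Finset.sum_equiv (Equiv.mulRight ρ) (fun τ => ?_) (fun τ _ => rfl)
  simp only [Finset.mem_filter, Finset.mem_univ, true_and, Equiv.coe_mulRight]
  refine forall₂_congr fun v hv => ?_
  rw [Equiv.Perm.mul_apply, hρ v hv]

/-- The image of a set partition under a permutation. -/
def permPartition (τ : Equiv.Perm (Fin n)) (π : SetPartition n) : SetPartition n :=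
  (π.map (Equiv.finsetCongr τ |>.toOrderIso
    (fun _ _ h => Finset.map_subset_map.2 h) (fun _ _ h => Finset.map_subset_map.2 h))).copy (Finset.map_univ_equiv τ)

lemma parts_permPartition (τ : Equiv.Perm (Fin n)) (π : SetPartition n) :
    (permPartition τ π).parts = π.parts.map (Equiv.finsetCongr τ).toEmbedding := by
  rfl

lemma elemFun_comp (τ : Equiv.Perm (Fin n)) (π : SetPartition n) (κ : Fin n → ℕ+) :
    elemFun π (κ ∘ τ) = elemFun (permPartition τ π) κ := by
  rw [elemFun, elemFun, Finset.prod_apply, Finset.prod_apply, parts_permPartition,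
    Finset.prod_map]
  refine Finset.prod_congr rfl fun B _ => ?_
  rw [← injInd_image]
  simp [Finset.map_eq_image]

lemma sim_permPartition {τ : Equiv.Perm (Fin n)} (hτ : FixesLast τ) (π : SetPartition n) :
    Sim (permPartition τ π) π := by
  constructor
  · rw [shape, shape, parts_permPartition, Finset.map_val, Multiset.map_map]
    exact Multiset.map_congr rfl fun B _ => Finset.card_map _
  · intro A hA B hB v hv hvA hvB
    rw [parts_permPartition, Finset.mem_map] at hA
    obtain ⟨B', hB', rfl⟩ := hA
    have : v ∈ B' := by
      simp only [Equiv.coe_toEmbedding, Equiv.finsetCongr_apply, Finset.mem_map] at hvA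
      obtain ⟨u, hu, huv⟩ := hvA
      rw [← hτ v hv] at huv
      rwa [← τ.injective huv]
    rw [π.eq_of_mem_parts hB hB' hvB this]
    simp

lemma Sim.symm {π σ : SetPartition n} (h : Sim π σ) : Sim σ π :=
  ⟨h.1.symm, fun A hA B hB v hv hvA hvB => (h.2 B hB A hA v hv hvB hvA).symm⟩

lemma Sim.trans {π σ ρ : SetPartition n} (h : Sim π σ) (h' : Sim σ ρ) : Sim π ρ := by
  refine ⟨h.1.trans h'.1, fun A hA B hB v hv hvA hvB => ?_⟩
  obtain ⟨D, hD, hvD⟩ := σ.exists_mem (Finset.mem_univ v)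
  exact (h.2 A hA D hD v hv hvA hvD).trans (h'.2 D hD B hB v hv hvD hvB)

-- The functional adding up the coefficients over one ∼-class is unchanged by the permutations
-- fixing n, so on a symmetrized function it returns the class sum times the nonzero number of those
-- permutations.
open Classical in
lemma classSum_eq_of_symmetrize_eq {c d : SetPartition n → ℚ}
    (h : symmetrize n (∑ π, c π • elemFun π) = symmetrize n (∑ π, d π • elemFun π))
    (π : SetPartition n) :
    ∑ σ with Sim σ π, c σ = ∑ σ with Sim σ π, d σ := by
  obtain ⟨ℓ, hℓ⟩ : ∃ ℓ : ((Fin n → ℕ+) → ℚ) →ₗ[ℚ] ℚ, ∀ σ,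
      ℓ (elemFun σ) = if Sim σ π then 1 else 0 := by
    let b := Module.Basis.extend (linearIndependent_elemFun (n := n)).linearIndepOn_id
    -- The e_σ are extended to a basis of all functions; the values on the added basis vectors do
    -- not matter.
    refine ⟨b.constr ℚ fun x => if ∃ σ, elemFun σ = x ∧ Sim σ π then 1 else 0, fun σ => ?_⟩
    have hmem : elemFun σ ∈ (linearIndependent_elemFun (n := n)).linearIndepOn_id.extend
        (Set.subset_univ _) :=
      Module.Basis.subset_extend _ ⟨σ, rfl⟩
    have hb : b ⟨elemFun σ, hmem⟩ = elemFun σ := Module.Basis.extend_apply_self _ _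
    rw [← hb, Module.Basis.constr_basis]
    refine if_congr ?_ rfl rfl
    constructor
    · rintro ⟨ρ, hρ, hs⟩
      rwa [← linearIndependent_elemFun.injective hρ]
    · exact fun hs => ⟨σ, rfl, hs⟩
  have key : ∀ c : SetPartition n → ℚ, ℓ (symmetrize n (∑ σ, c σ • elemFun σ)) =
      (Finset.univ.filter fun τ : Equiv.Perm (Fin n) => FixesLast τ).card *
        ∑ σ with Sim σ π, c σ := by
    intro c
    have h1 : ∀ σ, symmetrize n (elemFun σ) =
        ∑ τ : Equiv.Perm (Fin n) with FixesLast τ, elemFun (permPartition τ σ) := by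
      intro σ
      ext κ
      rw [symmetrize_apply, Finset.sum_apply]
      exact Finset.sum_congr rfl fun τ _ => elemFun_comp τ σ κ
    rw [map_sum, map_sum, Finset.sum_filter, Finset.mul_sum]
    refine Finset.sum_congr rfl fun σ _ => ?_
    rw [map_smul, map_smul, h1, map_sum]
    have h2 : ∀ τ ∈ Finset.univ.filter (fun τ : Equiv.Perm (Fin n) => FixesLast τ),
        ℓ (elemFun (permPartition τ σ)) = if Sim σ π then 1 else 0 := by
      intro τ hτ
      have hs := sim_permPartition (Finset.mem_filter.1 hτ).2 σ
      rw [hℓ]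
      exact if_congr ⟨fun h => hs.symm.trans h, fun h => hs.trans h⟩ rfl rfl
    rw [Finset.sum_congr rfl h2, Finset.sum_const]
    split_ifs <;> simp [mul_comm]
  have := congrArg ℓ h
  rw [key, key] at this
  refine mul_left_cancel₀ ?_ this
  have : (Finset.univ.filter fun τ : Equiv.Perm (Fin n) => FixesLast τ).card ≠ 0 :=
    Finset.card_ne_zero_of_mem (a := 1)
      (Finset.mem_filter.2 ⟨Finset.mem_univ _, fun _ _ => rfl⟩)
  exact_mod_cast this

theorem semiEquiv_toSeries {F F' : (Fin n → ℕ+) → ℚ}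
    (hF : F ∈ Submodule.span ℚ (Set.range (elemFun (n := n))))
    (hF' : F' ∈ Submodule.span ℚ (Set.range (elemFun (n := n))))
    (h : symmetrize n F = symmetrize n F') : SemiEquiv n (toSeries n F) (toSeries n F') := by
  have hr : Set.range (elem (n := n)) = toSeries n '' Set.range elemFun := by
    rw [← Set.range_comp]
    exact congrArg Set.range (funext elem_eq_toSeries)
  have hmem : ∀ F ∈ Submodule.span ℚ (Set.range (elemFun (n := n))),
      toSeries n F ∈ Submodule.span ℚ (Set.range (elem (n := n))) := fun F hF => by
    rw [hr, ← Submodule.map_span]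
    exact Submodule.mem_map_of_mem hF
  have hinv : ∀ (F : (Fin n → ℕ+) → ℚ) (c : SetPartition n → ℚ),
      toSeries n F = ∑ π, c π • elem π → F = ∑ π, c π • elemFun π := fun F c hc => by
    apply toSeries_injective
    rw [hc, map_sum]
    exact Finset.sum_congr rfl fun π _ => by rw [map_smul, elem_eq_toSeries]
  refine ⟨hmem F hF, hmem F' hF', fun c d hc hd π => ?_⟩
  apply classSum_eq_of_symmetrize_eq
  rw [← hinv F c hc, ← hinv F' d hd, h]

end Transfer

/-! ### Cutting a component into consecutive pieces -/

section Pieces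

variable {V K : Type*} [LinearOrder V]

/-- The elements of `C` other than its least element. -/
def nonMin (C : Finset V) : Finset V := {v ∈ C | ∃ u ∈ C, u < v}

/-- The piece of `v` after cutting `C` in front of each element of `T`. -/
def pieceOf (C T : Finset V) (v : V) : Finset V := {u ∈ C | ∀ t ∈ T, u < t ↔ v < t}

/-- The pieces obtained by cutting `C` in front of each element of `T`. -/
def pieces (C T : Finset V) : Finset (Finset V) := C.image (pieceOf C T)

/-- The right-most piece obtained by cutting `C` in front of each element of `T`. -/
def lastPiece (C T : Finset V) : Finset V := {u ∈ C | ∀ t ∈ T, t ≤ u}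

/-- The weighted elementary function of the pieces of `C` cut in front of the elements of `T`. -/
noncomputable def cutTerm (C T : Finset V) (κ : V → K) : ℚ :=
  (lastPiece C T).card * ∏ B ∈ pieces C T, injInd B κ / B.card.factorial

/-- The signed sum of `cutTerm C T` over all ways to cut `C`. -/
noncomputable def cutSum (C : Finset V) (κ : V → K) : ℚ :=
  ∑ T ∈ (nonMin C).powerset, (-1) ^ T.card * cutTerm C T κ

lemma pieceOf_subset (C T : Finset V) (v : V) : pieceOf C T v ⊆ C := Finset.filter_subset _ _

lemma nonMin_subset (C : Finset V) : nonMin C ⊆ C := Finset.filter_subset _ _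

lemma lastPiece_subset (C T : Finset V) : lastPiece C T ⊆ C := Finset.filter_subset _ _

lemma mem_pieceOf {C T : Finset V} {u v : V} :
    u ∈ pieceOf C T v ↔ u ∈ C ∧ ∀ t ∈ T, u < t ↔ v < t := Finset.mem_filter

lemma mem_lastPiece {C T : Finset V} {u : V} :
    u ∈ lastPiece C T ↔ u ∈ C ∧ ∀ t ∈ T, t ≤ u := Finset.mem_filter

lemma mem_pieceOf_self {C : Finset V} (T : Finset V) {v : V} (hv : v ∈ C) : v ∈ pieceOf C T v :=
  Finset.mem_filter.2 ⟨hv, fun _ _ => Iff.rfl⟩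

lemma cutTerm_congr {C : Finset V} (T : Finset V) {κ κ' : V → K} (h : ∀ v ∈ C, κ v = κ' v) :
    cutTerm C T κ = cutTerm C T κ' := by
  rw [cutTerm, cutTerm]
  congr 1
  refine Finset.prod_congr rfl fun B hB => ?_
  obtain ⟨v, -, rfl⟩ := Finset.mem_image.1 hB
  rw [injInd_congr fun u hu => h u (pieceOf_subset _ _ _ hu)]

lemma cutSum_congr {C : Finset V} {κ κ' : V → K} (h : ∀ v ∈ C, κ v = κ' v) :
    cutSum C κ = cutSum C κ' :=
  Finset.sum_congr rfl fun T _ => by rw [cutTerm_congr T h]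

lemma cutTerm_empty {C : Finset V} (hC : C.Nonempty) (κ : V → K) :
    cutTerm C ∅ κ = C.card * (injInd C κ / C.card.factorial) := by
  have h1 : pieceOf C ∅ = fun _ => C := by ext; simp [pieceOf]
  have h2 : lastPiece C ∅ = C := by simp [lastPiece]
  rw [cutTerm, h2, pieces, h1, Finset.image_const hC, Finset.prod_singleton]

lemma lt_of_mem_nonMin_upper {C : Finset V} {t v : V} (h : v ∈ nonMin {u ∈ C | t ≤ u}) :
    v ∈ C ∧ t < v := by
  simp only [nonMin, Finset.mem_filter] at h
  obtain ⟨⟨h1, -⟩, u, ⟨-, h2⟩, h3⟩ := h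
  exact ⟨h1, h2.trans_lt h3⟩

/-- Here t is the leftmost cut: everything before it is a single piece, and T cuts only what
follows. -/
lemma cutTerm_insert {C T : Finset V} {t : V} (ht : t ∈ nonMin C)
    (hT : T ⊆ nonMin {u ∈ C | t ≤ u}) (κ : V → K) :
    cutTerm C (insert t T) κ =
      injInd {u ∈ C | u < t} κ / ({u ∈ C | u < t} : Finset V).card.factorial *
        cutTerm {u ∈ C | t ≤ u} T κ := by
  have hTt : ∀ s ∈ T, t < s := fun s hs => (lt_of_mem_nonMin_upper (hT hs)).2
  have hlow : ∀ v ∈ C, v < t → pieceOf C (insert t T) v = {u ∈ C | u < t} := by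
    intro v _ hvt
    ext u
    simp only [pieceOf, Finset.mem_filter, Finset.forall_mem_insert, hvt, iff_true]
    refine and_congr_right fun _ => and_iff_left_of_imp fun hut s hs => ?_
    exact iff_of_true (hut.trans (hTt s hs)) (hvt.trans (hTt s hs))
  have hup : ∀ v ∈ C, t ≤ v →
      pieceOf C (insert t T) v = pieceOf {u ∈ C | t ≤ u} T v := by
    intro v _ hvt
    ext u
    simp only [pieceOf, Finset.mem_filter, Finset.forall_mem_insert, hvt.not_gt, iff_false, not_lt,
      and_assoc]
  have hp : pieces C (insert t T) = insert {u ∈ C | u < t} (pieces {u ∈ C | t ≤ u} T) := by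
    ext B
    simp only [pieces, Finset.mem_insert, Finset.mem_image]
    constructor
    · rintro ⟨v, hv, rfl⟩
      rcases lt_or_ge v t with h | h
      · exact Or.inl (hlow v hv h)
      · exact Or.inr ⟨v, Finset.mem_filter.2 ⟨hv, h⟩, (hup v hv h).symm⟩
    · rintro (rfl | ⟨v, hv, rfl⟩)
      · obtain ⟨-, u, hu, hut⟩ := Finset.mem_filter.1 ht
        exact ⟨u, hu, hlow u hu hut⟩
      · rw [Finset.mem_filter] at hv
        exact ⟨v, hv.1, hup v hv.1 hv.2⟩
  have hnot : ({u ∈ C | u < t} : Finset V) ∉ pieces {u ∈ C | t ≤ u} T := by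
    intro h
    obtain ⟨v, -, hv⟩ := Finset.mem_image.1 h
    obtain ⟨-, u, hu, hut⟩ := Finset.mem_filter.1 ht
    have : u ∈ ({u ∈ C | u < t} : Finset V) := Finset.mem_filter.2 ⟨hu, hut⟩
    rw [← hv] at this
    exact hut.not_ge (Finset.mem_filter.1 (pieceOf_subset _ _ _ this)).2
  have hl : lastPiece C (insert t T) = lastPiece {u ∈ C | t ≤ u} T := by
    ext u
    simp only [lastPiece, Finset.mem_filter, Finset.forall_mem_insert, and_assoc]
  rw [cutTerm, hp, hl, Finset.prod_insert hnot, cutTerm]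
  ring

/-- The nonempty cut sets are grouped by their least element t; removing t costs one sign. -/
lemma cutSum_eq_sub {C : Finset V} (hC : C.Nonempty) (κ : V → K) :
    cutSum C κ = C.card * (injInd C κ / C.card.factorial) -
      ∑ t ∈ nonMin C, injInd {u ∈ C | u < t} κ / ({u ∈ C | u < t} : Finset V).card.factorial *
        cutSum {u ∈ C | t ≤ u} κ := by
  rw [cutSum, ← Finset.add_sum_erase _ _ (Finset.empty_mem_powerset (nonMin C)),
    cutTerm_empty hC, Finset.card_empty, pow_zero, one_mul, sub_eq_add_neg]
  congr 1
  simp only [cutSum, Finset.mul_sum, ← Finset.sum_neg_distrib]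
  rw [Finset.sum_sigma']
  symm
  refine Finset.sum_bij (fun p _ => insert p.1 p.2) ?_ ?_ ?_ ?_
  · rintro ⟨t, T⟩ h
    simp only [Finset.mem_sigma, Finset.mem_powerset] at h
    rw [Finset.mem_erase, Finset.mem_powerset]
    refine ⟨Finset.insert_ne_empty _ _, Finset.insert_subset h.1 fun v hv => ?_⟩
    have hv' := lt_of_mem_nonMin_upper (h.2 hv)
    exact Finset.mem_filter.2 ⟨hv'.1, t, (Finset.mem_filter.1 h.1).1, hv'.2⟩
  · rintro ⟨t, T⟩ h ⟨s, S⟩ h' heq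
    simp only [Finset.mem_sigma, Finset.mem_powerset] at h h'
    dsimp only at heq
    have hT : ∀ v ∈ T, t < v := fun v hv => (lt_of_mem_nonMin_upper (h.2 hv)).2
    have hS : ∀ v ∈ S, s < v := fun v hv => (lt_of_mem_nonMin_upper (h'.2 hv)).2
    have hts : t = s := by
      have h1 : t ∈ insert s S := heq ▸ Finset.mem_insert_self t T
      have h2 : s ∈ insert t T := heq ▸ Finset.mem_insert_self s S
      rw [Finset.mem_insert] at h1 h2
      rcases h1 with h1 | h1
      · exact h1
      · rcases h2 with h2 | h2
        · exact h2.symm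
        · exact absurd (hS t h1) (hT s h2).not_gt
    subst hts
    have : T = S := by
      rw [← Finset.erase_insert (fun h => (hT t h).false),
        ← Finset.erase_insert (fun h => (hS t h).false), heq]
    rw [this]
  · intro T hT
    rw [Finset.mem_erase, Finset.mem_powerset] at hT
    have hne := Finset.nonempty_iff_ne_empty.2 hT.1
    have hmin := T.min'_mem hne
    refine ⟨⟨T.min' hne, T.erase (T.min' hne)⟩, ?_, Finset.insert_erase hmin⟩
    rw [Finset.mem_sigma, Finset.mem_powerset]
    refine ⟨hT.2 hmin, fun v hv => ?_⟩
    have hlt := T.min'_lt_of_mem_erase_min' hne hv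
    refine Finset.mem_filter.2 ⟨Finset.mem_filter.2
      ⟨(Finset.mem_filter.1 (hT.2 (Finset.mem_of_mem_erase hv))).1, hlt.le⟩, T.min' hne,
      Finset.mem_filter.2 ⟨(Finset.mem_filter.1 (hT.2 hmin)).1, le_rfl⟩, hlt⟩
  · rintro ⟨t, T⟩ h
    simp only [Finset.mem_sigma, Finset.mem_powerset] at h
    have hT : t ∉ T := fun ht => (lt_of_mem_nonMin_upper (h.2 ht)).2.false
    rw [cutTerm_insert h.1 h.2, Finset.card_insert_of_notMem hT]
    ring

end Pieces

/-! ### Permutations supported on a given set -/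

section Perm

variable {V : Type*} [DecidableEq V]

/-- A bijection from B to B' extends to a permutation of S, and by the identity outside S. -/
lemma exists_perm_image_eq {S B B' : Finset V} (hB : B ⊆ S) (hB' : B' ⊆ S)
    (h : B.card = B'.card) :
    ∃ τ : Equiv.Perm V, (∀ v ∉ S, τ v = v) ∧ B.image τ = B' := by
  have e : {x : S // x.1 ∈ B} ≃ {x : S // x.1 ∈ B'} := by
    refine Fintype.equivOfCardEq ?_
    rw [Fintype.card_subtype, Fintype.card_subtype]
    have : ∀ A ⊆ S, (Finset.univ.filter fun x : S => x.1 ∈ A).card = A.card := by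
      intro A hA
      refine Finset.card_bij (fun x _ => x.1) (by simp) (by simp) fun v hv => ?_
      exact ⟨⟨v, hA hv⟩, by simpa using hv, rfl⟩
    rw [this B hB, this B' hB', h]
  refine ⟨Equiv.Perm.ofSubtype e.extendSubtype,
    fun v hv => Equiv.Perm.ofSubtype_apply_of_not_mem _ hv, ?_⟩
  refine Finset.eq_of_subset_of_card_le (fun w hw => ?_) ?_
  · obtain ⟨v, hv, rfl⟩ := Finset.mem_image.1 hw
    rw [Equiv.Perm.ofSubtype_apply_of_mem _ (hB hv)]
    exact e.extendSubtype_mem ⟨v, hB hv⟩ hv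
  · rw [Finset.card_image_of_injective _ (Equiv.injective _), h]

lemma image_eq_self_of_support_subset {S C : Finset V} (hS : S ⊆ C) {τ : Equiv.Perm V}
    (hτ : ∀ v ∉ S, τ v = v) : C.image τ = C := by
  refine Finset.eq_of_subset_of_card_le (fun w hw => ?_) ?_
  · obtain ⟨v, hv, rfl⟩ := Finset.mem_image.1 hw
    by_contra h
    have := hτ (τ v) fun h' => h (hS h')
    rw [τ.injective this] at h
    exact h hv
  · rw [Finset.card_image_of_injective _ τ.injective]

end Perm

/-! ### Replacing power sums by signed cuts under symmetrization -/

section Block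

variable {n : ℕ}

/-- `(-1)^(|C|-1)` times the indicator of the colourings constant on `C`. -/
noncomputable def signedConst {V K : Type*} (C : Finset V) (κ : V → K) : ℚ :=
  (-1) ^ (C.card - 1) * constInd C κ

lemma scaledConst_eq_smul_signedConst {V K : Type*} (C : Finset V) :
    scaledConst (K := K) C = ((C.card - 1).factorial : ℚ) • signedConst C := by
  ext κ
  simp only [scaledConst, signedConst, Pi.smul_apply, smul_eq_mul]
  ring

/-- A permutation supported on C \ {m} carries B to B'. It fixes the last element of [n], which is
either m or outside C, and it leaves F unchanged because F only sees colours outside C. -/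
lemma symmetrize_mul_injInd_mul_signedConst {C : Finset (Fin n)} {m : Fin n}
    (hmax : ∀ v ∈ C, v ≤ m) {F : (Fin n → ℕ+) → ℚ} (hF : DependsOn F (C : Set (Fin n))ᶜ)
    {B B' : Finset (Fin n)} (hB : B ⊆ C.erase m) (hB' : B' ⊆ C.erase m)
    (h : B.card = B'.card) :
    symmetrize n (F * (injInd B * signedConst (C \ B))) =
      symmetrize n (F * (injInd B' * signedConst (C \ B'))) := by
  obtain ⟨τ, hτ, hτB⟩ := exists_perm_image_eq hB hB' h
  have hlast : FixesLast τ := fun v hv => hτ v fun h => by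
    rw [Finset.mem_erase] at h
    have h1 := hmax v h.2
    have h2 := m.isLt
    exact h.1 (le_antisymm h1 (by rw [Fin.le_def]; omega))
  have hC := image_eq_self_of_support_subset (Finset.erase_subset m C) hτ
  have hCB : (C \ B).image τ = C \ B' := by
    rw [Finset.image_sdiff _ _ τ.injective, hC, hτB]
  rw [← symmetrize_comp _ hlast]
  congr 1
  ext κ
  have hFκ : F (κ ∘ τ) = F κ := hF fun v hv => by
    rw [Function.comp_apply, hτ v fun h => hv (Finset.mem_of_mem_erase h)]
  have hcard : (C \ B').card = (C \ B).card := by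
    rw [← hCB, Finset.card_image_of_injective _ τ.injective]
  simp only [Pi.mul_apply, signedConst]
  rw [hFκ, ← injInd_image, ← constInd_image, hτB, hCB, hcard]

/-- The number of elements of C below t is the rank of t, a bijection from C onto {0, …, |C|-1}. It
turns a sum over the size of B into a sum over cut points. -/
lemma sum_card_filter_lt {V M : Type*} [LinearOrder V] [AddCommMonoid M] (C : Finset V)
    (f : ℕ → M) :
    ∑ t ∈ C, f ({u ∈ C | u < t} : Finset V).card = ∑ b ∈ Finset.range C.card, f b := by
  have hinj : Set.InjOn (fun t => ({u ∈ C | u < t} : Finset V).card) C := by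
    intro s hs t ht hst
    have key : ∀ s ∈ C, ∀ t ∈ C, s < t →
        ({u ∈ C | u < s} : Finset V).card < ({u ∈ C | u < t} : Finset V).card := by
      intro s hs t _ hst
      refine Finset.card_lt_card ((Finset.ssubset_iff_of_subset fun u hu => ?_).2
        ⟨s, by simp [hs, hst], by simp⟩)
      rw [Finset.mem_filter] at hu ⊢
      exact ⟨hu.1, hu.2.trans hst⟩
    rcases lt_trichotomy s t with h | h | h
    · exact absurd hst (key s hs t ht h).ne
    · exact h
    · exact absurd hst (key t ht s hs h).ne'
  have himg : C.image (fun t => ({u ∈ C | u < t} : Finset V).card) = Finset.range C.card := by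
    refine Finset.eq_of_subset_of_card_le (fun b hb => ?_) ?_
    · obtain ⟨t, ht, rfl⟩ := Finset.mem_image.1 hb
      exact Finset.mem_range.2 (Finset.card_lt_card (Finset.filter_ssubset.2 ⟨t, ht, lt_irrefl t⟩))
    · rw [Finset.card_range, Finset.card_image_of_injOn hinj]
  rw [← himg, Finset.sum_image hinj]

lemma sdiff_filter_lt {V : Type*} [LinearOrder V] (C : Finset V) (t : V) :
    C \ {u ∈ C | u < t} = {u ∈ C | t ≤ u} := by
  ext u; simp only [Finset.mem_sdiff, Finset.mem_filter, not_and, not_lt]; tauto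

/-- In Newton's identity at m = max C, all B of one size b contribute equally after symmetrization,
so each may be replaced by the initial segment of C of size b. -/
lemma symmetrize_mul_injInd {C : Finset (Fin n)} (hC : C.Nonempty) {F : (Fin n → ℕ+) → ℚ}
    (hF : DependsOn F (C : Set (Fin n))ᶜ) :
    symmetrize n (F * injInd C) = ((C.card - 1).factorial : ℚ) •
      ∑ t ∈ C, ((({u ∈ C | u < t} : Finset (Fin n)).card.factorial : ℚ)⁻¹) •
        symmetrize n (F * (injInd {u ∈ C | u < t} * signedConst {u ∈ C | t ≤ u})) := by
  set m := C.max' hC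
  have hm : m ∈ C := C.max'_mem hC
  have hN : injInd (K := ℕ+) C =
      ∑ B ∈ (C.erase m).powerset, injInd B * scaledConst (C \ B) := by
    ext κ
    simp [← newton_identity C hm κ]
  have hcard : (C.erase m).card + 1 = C.card := Finset.card_erase_add_one hm
  rw [hN, Finset.mul_sum, map_sum, Finset.sum_powerset, hcard, ← sum_card_filter_lt C,
    Finset.smul_sum]
  refine Finset.sum_congr rfl fun t ht => ?_
  have hlow : ({u ∈ C | u < t} : Finset (Fin n)) ⊆ C.erase m := fun u hu => by
    rw [Finset.mem_filter] at hu
    exact Finset.mem_erase.2 ⟨(hu.2.trans_le (C.le_max' t ht)).ne, hu.1⟩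
  set b := ({u ∈ C | u < t} : Finset (Fin n)).card with hb
  have hterm : ∀ B ∈ Finset.powersetCard b (C.erase m),
      symmetrize n (F * (injInd B * scaledConst (C \ B))) = ((C.card - b - 1).factorial : ℚ) •
        symmetrize n (F * (injInd {u ∈ C | u < t} * signedConst {u ∈ C | t ≤ u})) := by
    intro B hB
    rw [Finset.mem_powersetCard] at hB
    have hBC := hB.1.trans (Finset.erase_subset _ _)
    rw [scaledConst_eq_smul_signedConst, Finset.card_sdiff_of_subset hBC, hB.2, mul_smul_comm,
      mul_smul_comm, map_smul,
      symmetrize_mul_injInd_mul_signedConst (fun v hv => C.le_max' v hv) hF hB.1 hlow hB.2,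
      sdiff_filter_lt]
  rw [Finset.sum_congr rfl hterm, Finset.sum_const, Finset.card_powersetCard, smul_smul,
    ← Nat.cast_smul_eq_nsmul ℚ, smul_smul]
  congr 1
  have hle : b ≤ C.card - 1 := by
    have := Finset.card_le_card hlow
    omega
  -- There are choose(|C|-1, b) sets B, each weighted by (|C|-1-b)!, giving (|C|-1)!/b! in total.
  have := Nat.choose_mul_factorial_mul_factorial hle
  have h0 : (b.factorial : ℚ) ≠ 0 := by exact_mod_cast b.factorial_ne_zero
  rw [show (C.erase m).card = C.card - 1 by omega, show C.card - b - 1 = C.card - 1 - b by omega,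
    ← this]
  push_cast
  field_simp

lemma filter_lt_min' {V : Type*} [LinearOrder V] {C : Finset V} (hC : C.Nonempty) :
    ({u ∈ C | u < C.min' hC} : Finset V) = ∅ := by
  rw [Finset.filter_eq_empty_iff]
  exact fun u hu => (C.min'_le u hu).not_gt

lemma filter_min'_le {V : Type*} [LinearOrder V] {C : Finset V} (hC : C.Nonempty) :
    ({u ∈ C | C.min' hC ≤ u} : Finset V) = C :=
  Finset.filter_true_of_mem fun u hu => C.min'_le u hu

lemma nonMin_eq_erase {V : Type*} [LinearOrder V] {C : Finset V} (hC : C.Nonempty) :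
    nonMin C = C.erase (C.min' hC) := by
  ext v
  simp only [nonMin, Finset.mem_filter, Finset.mem_erase]
  constructor
  · rintro ⟨hv, u, hu, huv⟩
    exact ⟨((C.min'_le u hu).trans_lt huv).ne', hv⟩
  · rintro ⟨hv, hvC⟩
    exact ⟨hvC, _, C.min'_mem hC, lt_of_le_of_ne (C.min'_le v hvC) hv.symm⟩

/-- The recursion of `cutSum_eq_sub` subtracts, by induction, exactly the terms of
`symmetrize_mul_injInd` other than the one at the least element of C. -/
theorem symmetrize_mul_cutSum (C : Finset (Fin n)) (hC : C.Nonempty) (F : (Fin n → ℕ+) → ℚ)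
    (hF : DependsOn F (C : Set (Fin n))ᶜ) :
    symmetrize n (F * cutSum C) = symmetrize n (F * signedConst C) := by
  induction C using Finset.strongInduction generalizing F with
  | H C ih =>
    have hcut : F * cutSum C = ((C.card : ℚ) * (C.card.factorial : ℚ)⁻¹) • (F * injInd C) -
        ∑ t ∈ nonMin C, (({u ∈ C | u < t} : Finset (Fin n)).card.factorial : ℚ)⁻¹ •
          (F * injInd {u ∈ C | u < t} * cutSum {u ∈ C | t ≤ u}) := by
      ext κ
      simp only [Pi.mul_apply, Pi.sub_apply, Pi.smul_apply, Finset.sum_apply, smul_eq_mul]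
      rw [cutSum_eq_sub hC, mul_sub, Finset.mul_sum]
      congr 1
      · ring
      · exact Finset.sum_congr rfl fun t _ => by ring
    rw [hcut, map_sub, map_smul, symmetrize_mul_injInd hC hF, map_sum, smul_smul]
    have hone : (C.card : ℚ) * (C.card.factorial : ℚ)⁻¹ * ((C.card - 1).factorial : ℚ) = 1 := by
      obtain ⟨k, hk⟩ := Nat.exists_eq_succ_of_ne_zero hC.card_ne_zero
      have : (k.factorial : ℚ) ≠ 0 := by exact_mod_cast k.factorial_ne_zero
      rw [hk, Nat.factorial_succ]
      simp only [Nat.succ_eq_add_one, Nat.add_sub_cancel]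
      have : (k : ℚ) + 1 ≠ 0 := by positivity
      push_cast
      field_simp
    -- At t = min C the initial segment is empty, so this term is the desired F * `signedConst C`.
    rw [hone, one_smul, ← Finset.add_sum_erase _ _ (C.min'_mem hC), ← nonMin_eq_erase hC,
      filter_lt_min', filter_min'_le]
    have hlast : (F * (injInd ∅ * signedConst C) : (Fin n → ℕ+) → ℚ) = F * signedConst C := by
      ext κ; simp
    rw [hlast, Finset.card_empty, Nat.factorial_zero, Nat.cast_one, inv_one, one_smul,
      add_sub_assoc, add_eq_left, sub_eq_zero]
    refine Finset.sum_congr rfl fun t ht => ?_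
    simp only [nonMin, Finset.mem_filter] at ht
    obtain ⟨htC, u, hu, hut⟩ := ht
    rw [map_smul, ih {u ∈ C | t ≤ u} (Finset.filter_ssubset.2 ⟨u, hu, hut.not_ge⟩)
      ⟨t, Finset.mem_filter.2 ⟨htC, le_rfl⟩⟩, mul_assoc]
    -- The induction hypothesis is used with F times the factor of the initial segment, which does
    -- not see the colours on the remaining part of C.
    intro κ κ' h
    have h1 : F κ = F κ' := hF fun v hv => h v fun hv' =>
      hv (Finset.mem_filter.1 (Finset.mem_coe.1 hv')).1
    have h2 : injInd {u ∈ C | u < t} κ = injInd {u ∈ C | u < t} κ' := injInd_congr fun v hv =>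
      h v fun hv' => (Finset.mem_filter.1 hv).2.not_ge (Finset.mem_filter.1 (Finset.mem_coe.1 hv')).2
    simp only [Pi.mul_apply, h1, h2]

/-- Blocks are exchanged one at a time, F absorbing the factors of all other blocks; disjointness
keeps the dependence condition true. -/
theorem symmetrize_prod_cutSum (s : Finset (Finset (Fin n)))
    (hne : ∀ C ∈ s, C.Nonempty) (hs : (s : Set (Finset (Fin n))).PairwiseDisjoint id)
    (F : (Fin n → ℕ+) → ℚ) (hF : ∀ C ∈ s, DependsOn F (C : Set (Fin n))ᶜ) :
    symmetrize n (F * ∏ C ∈ s, cutSum C) = symmetrize n (F * ∏ C ∈ s, signedConst C) := by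
  induction s using Finset.induction_on generalizing F with
  | empty => simp
  | insert C s hC ih =>
    have hdis : ∀ A ∈ s, Disjoint C A := fun A hA =>
      hs (by simp) (by simp [hA]) (fun h => hC (h ▸ hA))
    rw [Finset.prod_insert hC, Finset.prod_insert hC, ← mul_assoc, ih, mul_right_comm,
      symmetrize_mul_cutSum C (hne C (by simp)), mul_assoc, mul_comm (∏ A ∈ s, signedConst A)]
    · intro κ κ' h
      have h1 : F κ = F κ' := hF C (by simp) h
      simp only [Pi.mul_apply, Finset.prod_apply, h1]
      congr 1
      refine Finset.prod_congr rfl fun A hA => ?_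
      rw [signedConst, signedConst, constInd_congr fun v hv => h v fun hv' => ?_]
      exact Finset.disjoint_left.1 (hdis A hA) hv' hv
    · exact fun A hA => hne A (by simp [hA])
    · exact hs.subset (by simp)
    · intro A hA κ κ' h
      have h1 : F κ = F κ' := hF A (by simp [hA]) h
      have h2 : cutSum C κ = cutSum C κ' := cutSum_congr fun v hv => h v fun hv' =>
        Finset.disjoint_left.1 (hdis A hA) hv hv'
      simp only [Pi.mul_apply, h1, h2]

end Block

/-! ### Counting labellings that increase on the blocks -/

section Labels

variable {n : ℕ}

/-- Sort the vertices by (f u, u) and by (f u, δ u); matching equal ranks rearranges each fibre so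
that δ becomes increasing on it. -/
lemma exists_perm_increasing_on_fibres {α : Type*} [LinearOrder α] (f : Fin n → α)
    (δ : Equiv.Perm (Fin n)) :
    ∃ h : Equiv.Perm (Fin n), f ∘ h = f ∧ ∀ u v, f u = f v → u < v → δ (h u) < δ (h v) := by
  set F₁ : Fin n → α ×ₗ Fin n := fun u => toLex (f u, u)
  set F₂ : Fin n → α ×ₗ Fin n := fun u => toLex (f u, δ u)
  have h₁ := Tuple.monotone_sort F₁
  have h₂ := Tuple.monotone_sort F₂
  set σ₁ := Tuple.sort F₁
  set σ₂ := Tuple.sort F₂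
  have hfst : ∀ {a b : α ×ₗ Fin n}, a ≤ b → (ofLex a).1 ≤ (ofLex b).1 := fun h => by
    rcases Prod.Lex.le_iff.1 h with h | h
    · exact h.le
    · exact h.1.le
  have hf : f ∘ σ₁ = f ∘ σ₂ :=
    Tuple.unique_monotone (fun i j hij => hfst (h₁ hij)) (fun i j hij => hfst (h₂ hij))
  have hh : ∀ u, f (σ₂ (σ₁.symm u)) = f u := fun u => by
    have := congrFun hf (σ₁.symm u)
    simpa using this.symm
  refine ⟨σ₁.symm.trans σ₂, funext hh, fun u v huv hlt => ?_⟩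
  have hij : σ₁.symm u < σ₁.symm v := by
    by_contra hle
    have := h₁ (not_lt.1 hle)
    simp only [Function.comp_apply, Equiv.apply_symm_apply, F₁] at this
    rcases Prod.Lex.le_iff.1 this with h | h
    · exact h.ne huv.symm
    · exact hlt.not_ge h.2
  simp only [Equiv.trans_apply]
  have := h₂ hij.le
  simp only [Function.comp_apply, F₂] at this
  rcases Prod.Lex.le_iff.1 this with h | h
  · simp only [ofLex_toLex, hh] at h
    exact absurd huv h.ne
  · refine lt_of_le_of_ne h.2 fun he => hij.ne ?_
    exact σ₂.injective (δ.injective he)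

/-- If k u < u, then monotonicity on the common fibre gives k (k u) < k u, against the induction
hypothesis at k u. -/
lemma le_apply_of_strictMono_on_fibres {α : Type*} {f : Fin n → α} {k : Equiv.Perm (Fin n)}
    (hk : f ∘ k = f) (hmono : ∀ u v, f u = f v → u < v → k u < k v) (u : Fin n) : u ≤ k u := by
  induction u using WellFoundedLT.induction with
  | ind u ih =>
    by_contra h
    rw [not_le] at h
    exact (hmono _ _ (congrFun hk u) h).not_ge (ih _ h)

lemma eq_one_of_strictMono_on_fibres {α : Type*} {f : Fin n → α} {k : Equiv.Perm (Fin n)}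
    (hk : f ∘ k = f) (hmono : ∀ u v, f u = f v → u < v → k u < k v) : k = 1 := by
  have hk' : f ∘ k.symm = f := by
    nth_rewrite 1 [← hk]
    ext; simp
  have hmono' : ∀ u v, f u = f v → u < v → k.symm u < k.symm v := by
    intro u v huv hlt
    by_contra h
    rcases (not_lt.1 h).lt_or_eq with h | h
    · have e : f (k.symm v) = f (k.symm u) :=
        (congrFun hk' v).trans (huv.symm.trans (congrFun hk' u).symm)
      have := hmono _ _ e h
      simp only [Equiv.apply_symm_apply] at this
      exact hlt.not_gt this
    · exact hlt.ne' (k.symm.injective h)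
  ext u
  have h1 := le_apply_of_strictMono_on_fibres hk hmono u
  have h2 := le_apply_of_strictMono_on_fibres hk' hmono' (k u)
  rw [Equiv.symm_apply_apply] at h2
  rw [le_antisymm h2 h1]
  rfl

/-- Every permutation factors uniquely as one increasing on the fibres of f composed with one
preserving f. -/
lemma card_increasing_mul_card_fibre_perms {α : Type*} [LinearOrder α] (f : Fin n → α) :
    Nat.card {δ : Equiv.Perm (Fin n) // ∀ u v, f u = f v → u < v → δ u < δ v} *
      Nat.card {h : Equiv.Perm (Fin n) // f ∘ h = f} = n.factorial := by
  rw [← Nat.card_prod]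
  have hb : Function.Bijective (fun p : {δ : Equiv.Perm (Fin n) //
      ∀ u v, f u = f v → u < v → δ u < δ v} × {h : Equiv.Perm (Fin n) // f ∘ h = f} =>
      p.1.1 * p.2.1) := by
    constructor
    · rintro ⟨⟨δ₁, hδ₁⟩, ⟨h₁, hh₁⟩⟩ ⟨⟨δ₂, hδ₂⟩, ⟨h₂, hh₂⟩⟩ heq
      dsimp only at heq
      have hinv : f ∘ h₂.symm = f := by
        nth_rewrite 1 [← hh₂]
        ext; simp
      have hδ : δ₂ = δ₁ * (h₁ * h₂⁻¹) := by rw [← mul_assoc, heq, mul_inv_cancel_right]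
      have hk : f ∘ (h₁ * h₂⁻¹ : Equiv.Perm (Fin n)) = f := by
        rw [Equiv.Perm.coe_mul, ← Function.comp_assoc, hh₁]
        exact hinv
      have hone : h₁ * h₂⁻¹ = 1 := by
        refine eq_one_of_strictMono_on_fibres hk fun u v huv hlt => ?_
        by_contra hle
        have h3 := hδ₂ u v huv hlt
        rw [hδ] at h3
        rcases (not_lt.1 hle).lt_or_eq with h | h
        · have e := (congrFun hk v).trans (huv.symm.trans (congrFun hk u).symm)
          exact (hδ₁ _ _ e h).not_gt h3
        · exact hlt.ne' ((h₁ * h₂⁻¹).injective h)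
      have : h₁ = h₂ := mul_inv_eq_one.1 hone
      subst this
      have : δ₁ = δ₂ := mul_right_cancel heq
      subst this
      rfl
    · intro δ
      obtain ⟨h, hf, hinc⟩ := exists_perm_increasing_on_fibres f δ
      have hinv : f ∘ h.symm = f := by
        nth_rewrite 1 [← hf]
        ext; simp
      exact ⟨⟨⟨δ * h, hinc⟩, ⟨h⁻¹, hinv⟩⟩, mul_inv_cancel_right δ h⟩
  rw [Nat.card_congr (Equiv.ofBijective _ hb), Nat.card_eq_fintype_card, Fintype.card_perm,
    Fintype.card_fin]

/-- The number of permutations of `[n]` which are increasing on each block of `π`. -/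
lemma card_increasing_mul_prod_factorial (π : SetPartition n) :
    Nat.card {δ : Equiv.Perm (Fin n) // ∀ u v, π.part u = π.part v → u < v → δ u < δ v} *
      ∏ B ∈ π.parts, B.card.factorial = n.factorial := by
  classical
  -- The colexicographic order serves only as some linear order on the blocks.
  have h := card_increasing_mul_card_fibre_perms (fun u => toColex (π.part u))
  have h' : Nat.card {h : Equiv.Perm (Fin n) // (fun u => toColex (π.part u)) ∘ h =
      fun u => toColex (π.part u)} = ∏ B ∈ π.parts, B.card.factorial := by
    have e : {h : Equiv.Perm (Fin n) // (fun u => toColex (π.part u)) ∘ h =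
        fun u => toColex (π.part u)} ≃ {h : Equiv.Perm (Fin n) // π.part ∘ h = π.part} :=
      Equiv.subtypeEquivRight fun h => by simp [funext_iff]
    rw [Nat.card_congr e, Nat.card_eq_fintype_card, DomMulAct.stabilizer_card]
    have hsub : ∏ B ∈ π.parts, (Fintype.card {a // π.part a = B}).factorial =
        ∏ B : Finset (Fin n), (Fintype.card {a // π.part a = B}).factorial := by
      refine Finset.prod_subset (Finset.subset_univ _) fun B _ hB => ?_
      have : IsEmpty {a // π.part a = B} :=
        ⟨fun a => hB (a.2 ▸ π.part_mem.2 (Finset.mem_univ a.1))⟩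
      rw [Fintype.card_eq_zero, Nat.factorial_zero]
    rw [← hsub]
    refine Finset.prod_congr rfl fun B hB => ?_
    congr 1
    rw [Fintype.card_subtype]
    congr 1
    ext a
    simp [π.part_eq_iff_mem hB]
  rw [← h, ← h']
  simp only [toColex_inj]

end Labels

/-! ### Counting star placements -/

section Stars

variable {V : Type*} [DecidableEq V] [Fintype V]

/-- The number of transversals of a set partition whose elements lie in prescribed subsets of the
blocks. -/
lemma card_transversals (Q : Finpartition (Finset.univ : Finset V)) (L : Finset V → Finset V)
    (hL : ∀ C, L C ⊆ C) :
    Nat.card {S : Finset V // (∀ u ∈ S, u ∈ L (Q.part u)) ∧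
      ∀ v, ∃! u, u ∈ S ∧ u ∈ Q.part v} = ∏ C ∈ Q.parts, (L C).card := by
  have key : ∀ g : (∀ C : Q.parts, L C.1), ∀ C : Q.parts, Q.part (g C).1 = C.1 := fun g C =>
    Q.part_eq_of_mem C.2 (hL _ (g C).2)
  have himg : ∀ g : (∀ C : Q.parts, L C.1),
      (∀ u ∈ Finset.univ.image fun C => (g C).1, u ∈ L (Q.part u)) ∧
      ∀ v, ∃! u, u ∈ (Finset.univ.image fun C => (g C).1) ∧ u ∈ Q.part v := by
    intro g
    constructor
    · intro u hu
      obtain ⟨C, -, rfl⟩ := Finset.mem_image.1 hu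
      rw [key]
      exact (g C).2
    · intro v
      have hv : Q.part v ∈ Q.parts := Q.part_mem.2 (Finset.mem_univ v)
      refine ⟨(g ⟨Q.part v, hv⟩).1, ⟨Finset.mem_image_of_mem _ (Finset.mem_univ _),
        hL _ (g ⟨Q.part v, hv⟩).2⟩, ?_⟩
      rintro u ⟨hu, huv⟩
      obtain ⟨C, -, rfl⟩ := Finset.mem_image.1 hu
      have : C = ⟨Q.part v, hv⟩ := Subtype.ext (by rw [← key g C, Q.part_eq_of_mem hv huv])
      rw [this]
  have hb : Function.Bijective (fun g : (∀ C : Q.parts, L C.1) =>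
      (⟨Finset.univ.image fun C => (g C).1, himg g⟩ : {S : Finset V // (∀ u ∈ S, u ∈ L (Q.part u)) ∧
      ∀ v, ∃! u, u ∈ S ∧ u ∈ Q.part v})) := by
    constructor
    · intro g g' h
      have h := Subtype.ext_iff.1 h
      dsimp only at h
      funext C
      have hm : (g C).1 ∈ Finset.univ.image fun C => (g' C).1 := by
        rw [← h]; exact Finset.mem_image_of_mem _ (Finset.mem_univ _)
      obtain ⟨C', -, hC'⟩ := Finset.mem_image.1 hm
      have : C' = C := Subtype.ext (by rw [← key g C, ← key g' C', hC'])
      subst this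
      exact Subtype.ext hC'.symm
    · rintro ⟨S, h1, h2⟩
      have hex : ∀ C : Q.parts, ∃ u : L C.1, u.1 ∈ S := by
        intro C
        obtain ⟨v, hv⟩ := Q.nonempty_of_mem_parts C.2
        obtain ⟨u, ⟨hu, huv⟩, -⟩ := h2 v
        rw [Q.part_eq_of_mem C.2 hv] at huv
        refine ⟨⟨u, ?_⟩, hu⟩
        have := h1 u hu
        rwa [Q.part_eq_of_mem C.2 huv] at this
      choose g hg using hex
      refine ⟨g, Subtype.ext ?_⟩
      ext u
      simp only [Finset.mem_image, Finset.mem_univ, true_and]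
      constructor
      · rintro ⟨C, rfl⟩
        exact hg C
      · intro hu
        have hp : Q.part u ∈ Q.parts := Q.part_mem.2 (Finset.mem_univ u)
        exact ⟨⟨Q.part u, hp⟩, (h2 u).unique ⟨hg _, hL _ (g ⟨Q.part u, hp⟩).2⟩
          ⟨hu, Q.mem_part_self.2 (Finset.mem_univ u)⟩⟩
  rw [← Nat.card_congr (Equiv.ofBijective _ hb), Nat.card_pi]
  simp only [Nat.card_eq_fintype_card, Fintype.card_coe]
  exact Finset.prod_coe_sort Q.parts fun C => (L C).card

end Stars

/-! ### Factoring sums over subsets of a disjoint union -/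

section Factor

variable {V ι : Type*} [DecidableEq V] [DecidableEq ι]

lemma sum_powerset_biUnion (s : Finset ι) (g : ι → Finset V)
    (hg : (s : Set ι).PairwiseDisjoint g) (f : ι → Finset V → ℚ) :
    ∑ T ∈ (s.biUnion g).powerset, ∏ C ∈ s, f C (T ∩ g C) =
      ∏ C ∈ s, ∑ T ∈ (g C).powerset, f C T := by
  induction s using Finset.induction_on with
  | empty => simp
  | insert C s hC ih =>
    have hdis : ∀ A ∈ s, Disjoint (g C) (g A) := fun A hA =>
      hg (by simp) (by simp [hA]) (fun h => hC (h ▸ hA))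
    have hdU : Disjoint (g C) (s.biUnion g) := (Finset.disjoint_biUnion_right _ _ _).2 hdis
    rw [Finset.prod_insert hC, ← ih (hg.subset (by simp)), Finset.sum_mul_sum,
      ← Finset.sum_product', Finset.biUnion_insert]
    refine Finset.sum_nbij' (fun T => (T ∩ g C, T ∩ s.biUnion g)) (fun p => p.1 ∪ p.2) ?_ ?_ ?_ ?_ ?_
    · intro T _
      simp
    · intro p hp
      rw [Finset.mem_product, Finset.mem_powerset, Finset.mem_powerset] at hp
      exact Finset.mem_powerset.2 (Finset.union_subset_union hp.1 hp.2)
    · intro T hT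
      rw [Finset.mem_powerset] at hT
      dsimp only
      rw [← Finset.inter_union_distrib_left, Finset.inter_eq_left.2 hT]
    · rintro ⟨T₁, T₂⟩ hp
      rw [Finset.mem_product, Finset.mem_powerset, Finset.mem_powerset] at hp
      dsimp only at hp ⊢
      rw [Finset.union_inter_distrib_right, Finset.union_inter_distrib_right,
        Finset.inter_eq_left.2 hp.1, Finset.inter_eq_left.2 hp.2,
        Finset.disjoint_iff_inter_eq_empty.1 (Finset.disjoint_of_subset_left hp.2 hdU.symm),
        Finset.disjoint_iff_inter_eq_empty.1 (Finset.disjoint_of_subset_left hp.1 hdU)]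
      simp
    · intro T _
      rw [Finset.prod_insert hC]
      congr 1
      refine Finset.prod_congr rfl fun A hA => ?_
      rw [Finset.inter_assoc, Finset.inter_eq_right.2 (Finset.subset_biUnion_of_mem g hA)]

end Factor

/-! ### Connected components of arc diagrams -/

variable {n : ℕ} {G : SimpleGraph (Fin n)}

namespace ArcDiagram

/-- The connectedness relation of an arc diagram. -/
def connSetoid (A : ArcDiagram G) : Setoid (Fin n) where
  r := A.Conn
  iseqv := ⟨fun _ => SimpleGraph.Reachable.refl _, fun h => h.symm, fun h h' => h.trans h'⟩

open Classical in
/-- The set partition of `[n]` into the connected components of an arc diagram. -/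
noncomputable def components (A : ArcDiagram G) : SetPartition n :=
  Finpartition.ofSetoid A.connSetoid

lemma mem_part_components (A : ArcDiagram G) {u v : Fin n} :
    v ∈ A.components.part u ↔ A.Conn u v := by
  classical
  exact Finpartition.mem_part_ofSetoid_iff_rel

lemma conn_of_mem_arcs (A : ArcDiagram G) {a : Fin n × Fin n} (ha : a ∈ A.arcs) :
    A.Conn a.1 a.2 :=
  SimpleGraph.Adj.reachable
    ((SimpleGraph.fromRel_adj _ _ _).2 ⟨(A.arcs_lt a ha).ne, Or.inl ha⟩)

/-- A property which is invariant along the arcs is invariant on connected components. -/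
lemma Conn.of_arcs {A : ArcDiagram G} {p : Fin n → Prop}
    (hp : ∀ a ∈ A.arcs, p a.1 ↔ p a.2) {u v : Fin n} (h : A.Conn u v) : p u ↔ p v := by
  obtain ⟨w⟩ := h
  induction w with
  | nil => exact Iff.rfl
  | cons hadj _ ih =>
    refine Iff.trans ?_ ih
    rcases ((SimpleGraph.fromRel_adj _ _ _).1 hadj).2 with h | h
    · exact hp _ h
    · exact (hp _ h).symm

/-- The right end points of the arcs. -/
def heads (A : ArcDiagram G) : Finset (Fin n) := A.arcs.image Prod.snd

lemma injOn_snd_arcs (A : ArcDiagram G) :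
    Set.InjOn Prod.snd (A.arcs : Set (Fin n × Fin n)) :=
  fun a ha b hb h => A.left_unique a ha b hb h

/-- The vertices with a left arc are those which are not the least vertex of their component. -/
lemma mem_heads_iff (A : ArcDiagram G) {v : Fin n} :
    v ∈ A.heads ↔ ∃ u, A.Conn v u ∧ u < v := by
  constructor
  · intro h
    obtain ⟨a, ha, rfl⟩ := Finset.mem_image.1 h
    exact ⟨a.1, (A.conn_of_mem_arcs ha).symm, A.arcs_lt a ha⟩
  · rintro ⟨u, hvu, huv⟩
    by_contra hv
    -- If v has no left arc, being a descendant of v is invariant along arcs in both directions, by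
    -- uniqueness of left arcs. So the whole component descends from v and lies weakly to its right.
    have key : Relation.ReflTransGen (fun i j => (i, j) ∈ A.arcs) v v ↔
        Relation.ReflTransGen (fun i j => (i, j) ∈ A.arcs) v u := by
      refine Conn.of_arcs (p := Relation.ReflTransGen (fun i j => (i, j) ∈ A.arcs) v) ?_ hvu
      intro a ha
      refine ⟨fun h => h.tail ha, fun h => ?_⟩
      rcases h.cases_tail with h | ⟨c, hc, hca⟩
      · exact absurd (Finset.mem_image.2 ⟨a, ha, h⟩) hv
      · have := A.left_unique _ hca _ ha rfl
        rwa [← this]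
    have h := key.1 Relation.ReflTransGen.refl
    have hle : ∀ w, Relation.ReflTransGen (fun i j => (i, j) ∈ A.arcs) v w → v ≤ w := by
      intro w hw
      induction hw with
      | refl => exact le_rfl
      | tail _ h ih => exact ih.trans (A.arcs_lt _ h).le
    exact huv.not_ge (hle u h)

lemma mem_nonMin_iff (A : ArcDiagram G) {C : Finset (Fin n)} (hC : C ∈ A.components.parts)
    {v : Fin n} : v ∈ nonMin C ↔ v ∈ C ∧ v ∈ A.heads := by
  simp only [nonMin, Finset.mem_filter, mem_heads_iff]
  refine and_congr_right fun hv => ?_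
  have : ∀ u, u ∈ C ↔ A.Conn v u := fun u => by
    rw [← mem_part_components, A.components.part_eq_of_mem hC hv]
  simp only [this]

lemma heads_eq_biUnion (A : ArcDiagram G) : A.heads = A.components.parts.biUnion nonMin := by
  ext v
  rw [Finset.mem_biUnion]
  constructor
  · intro hv
    have hp : A.components.part v ∈ A.components.parts :=
      A.components.part_mem.2 (Finset.mem_univ v)
    exact ⟨_, hp, (A.mem_nonMin_iff hp).2
      ⟨A.components.mem_part_self.2 (Finset.mem_univ v), hv⟩⟩
  · rintro ⟨C, hC, hv⟩
    exact ((A.mem_nonMin_iff hC).1 hv).2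

lemma pairwiseDisjoint_nonMin (A : ArcDiagram G) :
    (A.components.parts : Set (Finset (Fin n))).PairwiseDisjoint nonMin :=
  fun _ hC _ hD hne => Finset.disjoint_of_subset_left (nonMin_subset _)
    (Finset.disjoint_of_subset_right (nonMin_subset _) (A.components.disjoint hC hD hne))

open Classical in
/-- The product over the arcs of `-1` or `0`, according to whether the ends have the same colour. -/
lemma prod_arcs_eq_prod_signedConst (A : ArcDiagram G) {K : Type*} (κ : Fin n → K) :
    ∏ a ∈ A.arcs, (if κ a.1 = κ a.2 then (-1 : ℚ) else 0) =
      ∏ C ∈ A.components.parts, signedConst C κ := by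
  -- Arcs correspond to their right ends, which are the vertices that are not least in their
  -- component; hence there are ∑ (|C|-1) arcs.
  have hsign : ∏ C ∈ A.components.parts, (-1 : ℚ) ^ (C.card - 1) = (-1) ^ A.arcs.card := by
    have h1 : ∀ C ∈ A.components.parts, (-1 : ℚ) ^ (C.card - 1) = (-1) ^ (nonMin C).card := by
      intro C hC
      have hne := A.components.nonempty_of_mem_parts hC
      rw [nonMin_eq_erase hne, Finset.card_erase_of_mem (C.min'_mem hne)]
    rw [Finset.prod_congr rfl h1, Finset.prod_pow_eq_pow_sum,
      ← Finset.card_biUnion A.pairwiseDisjoint_nonMin, ← A.heads_eq_biUnion, heads,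
      Finset.card_image_of_injOn A.injOn_snd_arcs]
  simp only [signedConst]
  rw [Finset.prod_mul_distrib, hsign, prod_constInd_apply, Finset.prod_ite_zero, Finset.prod_const]
  have hiff : (∀ a ∈ A.arcs, κ a.1 = κ a.2) ↔
      ∀ C ∈ A.components.parts, ∀ u ∈ C, ∀ v ∈ C, κ u = κ v := by
    constructor
    · intro h C hC u hu v hv
      rw [← A.components.part_eq_of_mem hC hu, mem_part_components] at hv
      refine ((Conn.of_arcs (p := fun w => κ u = κ w) (fun a ha => ?_) hv).1 rfl)
      rw [h a ha]
    · intro h a ha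
      refine h _ (A.components.part_mem.2 (Finset.mem_univ a.1)) _
        (A.components.mem_part_self.2 (Finset.mem_univ a.1)) _ ?_
      exact A.mem_part_components.2 (A.conn_of_mem_arcs ha)
  by_cases h : ∀ a ∈ A.arcs, κ a.1 = κ a.2
  · rw [if_pos h, if_pos (hiff.1 h), mul_one]
  · rw [if_neg h, if_neg (mt hiff.2 h), mul_zero]

end ArcDiagram

instance (G : SimpleGraph (Fin n)) : Finite (ArcDiagram G) :=
  Finite.of_injective (fun A => A.arcs) fun _ _ h => ArcDiagram.ext h

noncomputable instance (G : SimpleGraph (Fin n)) : Fintype (ArcDiagram G) := Fintype.ofFinite _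

instance (G : SimpleGraph (Fin n)) : Finite (TicDiagram G) :=
  Finite.of_injective (fun D => (D.arcs, D.tics)) fun _ _ h =>
    TicDiagram.ext (Prod.mk.inj h).1 (Prod.mk.inj h).2

noncomputable instance (G : SimpleGraph (Fin n)) : Fintype (TicDiagram G) := Fintype.ofFinite _

/-! ### Expansion of Y_G over arc diagrams -/

section Expansion

-- Two left neighbours of j sharing its colour would be adjacent by the clique condition,
-- contradicting properness before j; so the sum is 0 or 1.
open Classical in
lemma one_sub_sum_conflicts {K : Type*} (κ : Fin n → K) {j : Fin n}
    (hclique : ∀ i i', i < i' → i' < j → G.Adj i j → G.Adj i' j → G.Adj i i')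
    (hprop : ∀ u v, u < j → v < j → G.Adj u v → κ u ≠ κ v) :
    1 - ∑ i with i < j ∧ G.Adj i j, (if κ i = κ j then (1 : ℚ) else 0) =
      if ∀ i < j, G.Adj i j → κ i ≠ κ j then 1 else 0 := by
  split_ifs with h
  · rw [Finset.sum_eq_zero, sub_zero]
    intro i hi
    rw [Finset.mem_filter] at hi
    exact if_neg (h i hi.2.1 hi.2.2)
  · push Not at h
    obtain ⟨i, hij, hadj, hκ⟩ := h
    rw [Finset.sum_eq_single i]
    · simp [hκ]
    · intro i' hi' hne
      rw [Finset.mem_filter] at hi'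
      refine if_neg fun hκ' => ?_
      rcases lt_or_gt_of_ne hne with hlt | hlt
      · exact hprop i' i hi'.2.1 hij (hclique i' i hlt hij hi'.2.2 hadj) (hκ'.trans hκ.symm)
      · exact hprop i i' hij hi'.2.1 (hclique i i' hlt hi'.2.1 hadj hi'.2.2) (hκ.trans hκ'.symm)
    · exact fun h => absurd (Finset.mem_filter.2 ⟨Finset.mem_univ i, hij, hadj⟩) h

open Classical in
lemma prod_one_sub_sum_conflicts {K : Type*} (κ : Fin n → K)
    (hclique : ∀ i i' j, i < i' → i' < j → G.Adj i j → G.Adj i' j → G.Adj i i') :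
    ∏ j, (1 - ∑ i with i < j ∧ G.Adj i j, (if κ i = κ j then (1 : ℚ) else 0)) =
      if ∀ u v, G.Adj u v → κ u ≠ κ v then 1 else 0 := by
  split_ifs with h
  · refine Finset.prod_eq_one fun j _ => ?_
    rw [Finset.sum_eq_zero, sub_zero]
    intro i hi
    rw [Finset.mem_filter] at hi
    exact if_neg (h i j hi.2.2)
  · have hex : ∃ j, ∃ i < j, G.Adj i j ∧ κ i = κ j := by
      push Not at h
      obtain ⟨u, v, hadj, hκ⟩ := h
      rcases lt_or_gt_of_ne hadj.ne with hlt | hlt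
      · exact ⟨v, u, hlt, hadj, hκ⟩
      · exact ⟨u, v, hlt, hadj.symm, hκ.symm⟩
    -- Before the first vertex j with a conflict the colouring is proper, so the factor at j
    -- vanishes.
    obtain ⟨j, hj, hmin⟩ := WellFounded.has_min (wellFounded_lt (α := Fin n)) _ hex
    refine Finset.prod_eq_zero (Finset.mem_univ j) ?_
    rw [one_sub_sum_conflicts κ (fun i i' => hclique i i' j), if_neg]
    · obtain ⟨i, hij, hadj, hκ⟩ := hj
      exact fun h => h i hij hadj hκ
    · intro u v hu hv hadj hκ
      rcases lt_or_gt_of_ne hadj.ne with hlt | hlt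
      · exact hmin v ⟨u, hlt, hadj, hκ⟩ hv
      · exact hmin u ⟨v, hlt, hadj.symm, hκ.symm⟩ hu

/-- The arc diagram in which `g j` is the left neighbour of `j`, unless `g j = j`. -/
def arcDiagramOfParents (g : Fin n → Fin n)
    (hg : ∀ j, g j = j ∨ (g j < j ∧ G.Adj (g j) j)) : ArcDiagram G where
  arcs := {a | a.1 = g a.2 ∧ a.1 ≠ a.2}
  arcs_lt := fun a ha => by
    rw [Finset.mem_filter] at ha
    rcases hg a.2 with h | h
    · exact absurd (ha.2.1.trans h) ha.2.2
    · rw [ha.2.1]; exact h.1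
  arcs_adj := fun a ha => by
    rw [Finset.mem_filter] at ha
    rcases hg a.2 with h | h
    · exact absurd (ha.2.1.trans h) ha.2.2
    · rw [ha.2.1]; exact h.2
  left_unique := fun a ha b hb h => by
    rw [Finset.mem_filter] at ha hb
    exact Prod.ext (by rw [ha.2.1, hb.2.1, h]) h

-- Multiplying out picks a parent for each vertex; the summand 1 is encoded as j being its own
-- parent, that is, having no left arc.
open Classical in
lemma prod_one_sub_sum_conflicts_eq_sum {K : Type*} (κ : Fin n → K) :
    ∏ j, (1 - ∑ i with i < j ∧ G.Adj i j, (if κ i = κ j then (1 : ℚ) else 0)) =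
      ∑ A : ArcDiagram G, ∏ a ∈ A.arcs, (if κ a.1 = κ a.2 then (-1 : ℚ) else 0) := by
  have h1 : ∀ j : Fin n, 1 - ∑ i with i < j ∧ G.Adj i j, (if κ i = κ j then (1 : ℚ) else 0) =
      ∑ i ∈ insert j (Finset.univ.filter fun i => i < j ∧ G.Adj i j),
        if i = j then 1 else if κ i = κ j then (-1 : ℚ) else 0 := by
    intro j
    rw [Finset.sum_insert (by simp), if_pos rfl, sub_eq_add_neg, ← Finset.sum_neg_distrib]
    congr 1
    refine Finset.sum_congr rfl fun i hi => ?_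
    rw [if_neg (Finset.mem_filter.1 hi).2.1.ne]
    split_ifs <;> simp
  rw [Finset.prod_congr rfl fun j _ => h1 j, Finset.prod_univ_sum]
  have hmem : ∀ g ∈ Fintype.piFinset fun j : Fin n =>
      insert j (Finset.univ.filter fun i => i < j ∧ G.Adj i j),
      ∀ j, g j = j ∨ (g j < j ∧ G.Adj (g j) j) := by
    intro g hg j
    simpa using Fintype.mem_piFinset.1 hg j
  refine Finset.sum_bij (fun g hg => arcDiagramOfParents g (hmem g hg)) (by simp) ?_ ?_ ?_
  · intro g hg g' hg' h
    have h := congrArg ArcDiagram.arcs h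
    funext j
    have hj := fun a : Fin n × Fin n => Finset.ext_iff.1 h a
    simp only [arcDiagramOfParents, Finset.mem_filter, Finset.mem_univ, true_and] at hj
    by_cases hgj : g j = j
    · by_contra hne
      have := (hj (g' j, j)).2 ⟨rfl, fun h => hne (hgj.trans h.symm)⟩
      exact hne this.1.symm
    · exact ((hj (g j, j)).1 ⟨rfl, hgj⟩).1
  · intro A _
    have hex : ∀ j : Fin n, ∃ i, ((i, j) ∈ A.arcs) ∨ (i = j ∧ j ∉ A.heads) := by
      intro j
      by_cases hj : j ∈ A.heads
      · obtain ⟨a, ha, rfl⟩ := Finset.mem_image.1 hj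
        exact ⟨a.1, Or.inl ha⟩
      · exact ⟨j, Or.inr ⟨rfl, hj⟩⟩
    choose g hg using hex
    refine ⟨g, ?_, ?_⟩
    · rw [Fintype.mem_piFinset]
      intro j
      rcases hg j with h | h
      · have h1 := A.arcs_lt _ h
        have h2 := A.arcs_adj _ h
        simp only at h1 h2
        simp [h1, h2]
      · simp [h.1]
    · apply ArcDiagram.ext
      ext ⟨i, j⟩
      simp only [arcDiagramOfParents, Finset.mem_filter, Finset.mem_univ, true_and]
      constructor
      · rintro ⟨rfl, hne⟩
        rcases hg j with h | h
        · exact h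
        · exact absurd h.1 hne
      · intro h
        refine ⟨?_, (A.arcs_lt _ h).ne⟩
        rcases hg j with h' | h'
        · exact congrArg Prod.fst (A.left_unique _ h _ h' rfl)
        · exact absurd (Finset.mem_image.2 ⟨_, h, rfl⟩) h'.2
  · intro g hg
    rw [← Finset.prod_subset (Finset.filter_subset (fun j => g j ≠ j) Finset.univ)]
    · refine Finset.prod_bij (fun j _ => (g j, j)) ?_ ?_ ?_ ?_
      · intro j hj
        simpa [arcDiagramOfParents] using hj
      · intro j _ j' _ h
        exact congrArg Prod.snd h
      · rintro ⟨i, j⟩ h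
        simp only [arcDiagramOfParents, Finset.mem_filter, Finset.mem_univ, true_and] at h
        exact ⟨j, by simpa using h.1 ▸ h.2, by rw [h.1]⟩
      · intro j hj
        rw [if_neg (Finset.mem_filter.1 hj).2]
    · intro j _ hj
      rw [if_pos]
      simpa using hj

lemma IsUnitInterval.adj_of_adj (hG : IsUnitInterval G) {i i' j : Fin n} (h : i < i')
    (h' : i' < j) (hij : G.Adj i j) : G.Adj i i' := by
  obtain ⟨S, -, hS⟩ := hG
  rw [hS] at hij ⊢
  obtain ⟨-, p, hp, hi, hj⟩ := hij
  exact ⟨h.ne, p, hp, hi, ⟨hi.1.trans h.le, h'.le.trans hj.2⟩⟩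

/-- The expansion of `Y_G` into power sums indexed by the arc diagrams of `G`. -/
theorem chromY_eq_toSeries (hG : IsUnitInterval G) :
    chromY G = toSeries n (∑ A : ArcDiagram G, ∏ C ∈ A.components.parts, signedConst C) := by
  classical
  rw [chromY, formalSum_eq_toSeries]
  congr 1
  ext κ
  simp only [Finset.sum_apply, Finset.prod_apply]
  rw [Finset.sum_congr rfl fun A _ => (A.prod_arcs_eq_prod_signedConst κ).symm,
    ← prod_one_sub_sum_conflicts_eq_sum, prod_one_sub_sum_conflicts κ
      fun i i' j h h' hij _ => hG.adj_of_adj h h' hij]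
  by_cases h : ∀ u v, G.Adj u v → κ u ≠ κ v
  · rw [if_pos h, if_pos (Set.mem_ofPred_eq ▸ h)]
  · rw [if_neg h]
    exact if_neg fun h' => h h'

end Expansion

/-! ### Pieces, labellings and stars of diagrams with tic marks -/

namespace TicDiagram

/-- The right end points of the marked arcs. -/
def cuts (D : TicDiagram G) : Finset (Fin n) := D.tics.image Prod.snd

lemma cuts_subset_heads (D : TicDiagram G) : D.cuts ⊆ D.toArcDiagram.heads :=
  Finset.image_subset_image D.tics_subset

lemma mem_cuts_inter_nonMin (D : TicDiagram G) {C : Finset (Fin n)}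
    (hC : C ∈ D.components.parts) {t : Fin n} :
    t ∈ D.cuts ∩ nonMin C ↔ t ∈ D.cuts ∧ t ∈ C := by
  rw [Finset.mem_inter, D.mem_nonMin_iff hC]
  exact and_congr_right fun h => and_iff_left (D.cuts_subset_heads h)

lemma mem_part_partition (D : TicDiagram G) {u v : Fin n} :
    v ∈ D.partition.part u ↔ D.SamePiece u v := by
  classical
  exact Finpartition.mem_part_ofSetoid_iff_rel

/-- Only the right end of a marked arc matters for the cutting, so the pieces of a component are
those of `pieceOf`. -/
lemma part_partition (D : TicDiagram G) {C : Finset (Fin n)} (hC : C ∈ D.components.parts)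
    {u : Fin n} (hu : u ∈ C) : D.partition.part u = pieceOf C (D.cuts ∩ nonMin C) u := by
  have hconn : ∀ v, v ∈ C ↔ D.Conn u v := fun v => by
    rw [← ArcDiagram.mem_part_components, D.components.part_eq_of_mem hC hu]
  ext v
  rw [mem_part_partition, SamePiece, mem_pieceOf, hconn]
  refine and_congr_right fun _ => ?_
  simp only [D.mem_cuts_inter_nonMin hC]
  constructor
  · rintro h t ⟨ht, htC⟩
    obtain ⟨a, ha, rfl⟩ := Finset.mem_image.1 ht
    exact (h a ha ((hconn _).1 htC).symm).symm
  · intro h a ha hconn'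
    exact (h a.2 ⟨Finset.mem_image_of_mem _ ha, (hconn _).2 hconn'.symm⟩).symm

lemma parts_partition (D : TicDiagram G) :
    D.partition.parts =
      D.components.parts.biUnion fun C => pieces C (D.cuts ∩ nonMin C) := by
  ext B
  simp only [Finset.mem_biUnion, pieces, Finset.mem_image]
  constructor
  · intro hB
    obtain ⟨u, hu⟩ := D.partition.nonempty_of_mem_parts hB
    have hC : D.components.part u ∈ D.components.parts :=
      D.components.part_mem.2 (Finset.mem_univ u)
    have huC := D.components.mem_part_self.2 (Finset.mem_univ u)
    exact ⟨_, hC, u, huC, by rw [← D.part_partition hC huC, D.partition.part_eq_of_mem hB hu]⟩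
  · rintro ⟨C, hC, u, hu, rfl⟩
    rw [← D.part_partition hC hu]
    exact D.partition.part_mem.2 (Finset.mem_univ u)

lemma prod_parts_partition (D : TicDiagram G) (f : Finset (Fin n) → ℚ) :
    ∏ B ∈ D.partition.parts, f B =
      ∏ C ∈ D.components.parts, ∏ B ∈ pieces C (D.cuts ∩ nonMin C), f B := by
  rw [parts_partition, Finset.prod_biUnion]
  intro C hC C' hC' hne
  rw [Function.onFun, Finset.disjoint_left]
  intro B hB hB'
  obtain ⟨u, hu, rfl⟩ := Finset.mem_image.1 hB
  obtain ⟨u', hu', h⟩ := Finset.mem_image.1 hB'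
  have h1 : u ∈ pieceOf C' (D.cuts ∩ nonMin C') u' := by
    rw [h]; exact mem_pieceOf_self _ hu
  exact Finset.disjoint_left.1 (D.components.disjoint hC hC' hne) hu (pieceOf_subset _ _ _ h1)

lemma inRightmostPiece_iff (D : TicDiagram G) (u : Fin n) :
    D.InRightmostPiece u ↔ u ∈ lastPiece (D.components.part u)
      (D.cuts ∩ nonMin (D.components.part u)) := by
  have hC : D.components.part u ∈ D.components.parts :=
    D.components.part_mem.2 (Finset.mem_univ u)
  rw [mem_lastPiece]
  simp only [D.mem_cuts_inter_nonMin hC, D.components.mem_part_self, Finset.mem_univ, true_and,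
    ArcDiagram.mem_part_components]
  constructor
  · rintro h t ⟨ht, hut⟩
    by_contra hlt
    rw [not_le] at hlt
    obtain ⟨a, ha, rfl⟩ := Finset.mem_image.1 ht
    exact hlt.not_gt (h a.2 hut fun hs => ((hs.2 a ha hut.symm).1 hlt).false)
  · intro h v huv hs
    by_contra hlt
    refine hs ⟨huv, fun a ha hau => ?_⟩
    have h1 := h a.2 ⟨Finset.mem_image_of_mem _ ha, hau.symm⟩
    exact iff_of_false h1.not_gt (h1.trans (not_lt.1 hlt)).not_gt

/-- The labellings of a diagram. -/
abbrev Labels (D : TicDiagram G) : Type :=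
  {δ : Equiv.Perm (Fin n) // ∀ u v, D.SamePiece u v → u < v → δ u < δ v}

/-- The ways to place the stars in a diagram. -/
abbrev Stars (D : TicDiagram G) : Type :=
  {S : Finset (Fin n) // (∀ u ∈ S, D.InRightmostPiece u) ∧
    ∀ v, ∃! u, u ∈ S ∧ D.Conn v u}

lemma card_labels_mul (D : TicDiagram G) :
    Nat.card D.Labels * ∏ B ∈ D.partition.parts, B.card.factorial = n.factorial := by
  rw [← card_increasing_mul_prod_factorial D.partition]
  congr 2
  have : ∀ u v, D.partition.part u = D.partition.part v ↔ D.SamePiece u v := fun u v => by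
    rw [← mem_part_partition, D.partition.mem_part_iff_part_eq_part (Finset.mem_univ _)
      (Finset.mem_univ _), eq_comm]
  simp only [this]

lemma card_stars (D : TicDiagram G) :
    Nat.card D.Stars =
      ∏ C ∈ D.components.parts, (lastPiece C (D.cuts ∩ nonMin C)).card := by
  rw [← card_transversals D.components (fun C => lastPiece C (D.cuts ∩ nonMin C))
    fun C => lastPiece_subset _ _]
  simp only [Stars, inRightmostPiece_iff, ArcDiagram.mem_part_components]

lemma card_labels_mul_card_stars_mul_elemFun (D : TicDiagram G) (κ : Fin n → ℕ+) :
    (Nat.card (D.Labels × D.Stars) : ℚ) * elemFun D.partition κ =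
      n.factorial * ∏ C ∈ D.components.parts, cutTerm C (D.cuts ∩ nonMin C) κ := by
  have hl : (Nat.card D.Labels : ℚ) * ∏ B ∈ D.partition.parts, (B.card.factorial : ℚ) =
      n.factorial := by exact_mod_cast D.card_labels_mul
  have hne : ∏ B ∈ D.partition.parts, (B.card.factorial : ℚ) ≠ 0 :=
    Finset.prod_ne_zero_iff.2 fun B _ => by exact_mod_cast B.card.factorial_ne_zero
  simp only [cutTerm]
  rw [Finset.prod_mul_distrib, ← D.prod_parts_partition, Finset.prod_div_distrib, Nat.card_prod,
    card_stars, elemFun, Finset.prod_apply, ← hl]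
  push_cast
  field_simp

end TicDiagram

/-- A labelled diagram consists of a diagram, a labelling and a placement of the stars. -/
def labeledDiagramEquiv (G : SimpleGraph (Fin n)) :
    LabeledDiagram G ≃ Σ D : TicDiagram G, D.Labels × D.Stars where
  toFun D := ⟨D.toTicDiagram, ⟨D.label, D.label_increasing⟩,
    ⟨D.stars, D.stars_rightmost, D.stars_unique⟩⟩
  invFun x :=
    { x.1 with
      label := x.2.1.1
      label_increasing := x.2.1.2
      stars := x.2.2.1
      stars_rightmost := x.2.2.2.1
      stars_unique := x.2.2.2.2 }
  left_inv _ := rfl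
  right_inv _ := rfl

/-- A diagram with tic marks consists of an arc diagram and a set of marked arcs. -/
def ticDiagramEquiv (G : SimpleGraph (Fin n)) :
    TicDiagram G ≃ Σ A : ArcDiagram G, A.arcs.powerset where
  toFun D := ⟨D.toArcDiagram, D.tics, Finset.mem_powerset.2 D.tics_subset⟩
  invFun x := { x.1 with tics := x.2.1, tics_subset := Finset.mem_powerset.1 x.2.2 }
  left_inv _ := rfl
  right_inv _ := rfl

lemma sum_powerset_cuts (A : ArcDiagram G) (κ : Fin n → ℕ+) :
    ∑ T ∈ A.arcs.powerset, (-1) ^ T.card *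
        ∏ C ∈ A.components.parts, cutTerm C (T.image Prod.snd ∩ nonMin C) κ =
      ∏ C ∈ A.components.parts, cutSum C κ := by
  -- An arc is determined by its right end, so sets of marked arcs correspond to sets of cut points.
  have hinj : Set.InjOn (Finset.image Prod.snd) (A.arcs.powerset : Set (Finset (Fin n × Fin n))) :=
    fun S hS T hT h => by
      rw [Finset.mem_coe, Finset.mem_powerset] at hS hT
      exact Finset.image_injOn_powerset_of_injOn A.injOn_snd_arcs
        (Finset.mem_powerset.2 hS) (Finset.mem_powerset.2 hT) h
  simp only [cutSum]
  rw [← sum_powerset_biUnion _ _ A.pairwiseDisjoint_nonMin, ← A.heads_eq_biUnion,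
    ArcDiagram.heads, Finset.powerset_image, Finset.sum_image hinj]
  refine Finset.sum_congr rfl fun T hT => ?_
  rw [Finset.mem_powerset] at hT
  rw [Finset.prod_mul_distrib, Finset.prod_pow_eq_pow_sum, ← Finset.card_biUnion,
    ← Finset.inter_biUnion, ← A.heads_eq_biUnion, Finset.inter_eq_left.2,
    Finset.card_image_of_injOn (A.injOn_snd_arcs.mono hT)]
  · exact Finset.image_subset_image hT
  · exact fun C hC C' hC' hne => Finset.disjoint_of_subset_left Finset.inter_subset_right
      (Finset.disjoint_of_subset_right Finset.inter_subset_right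
        (A.pairwiseDisjoint_nonMin hC hC' hne))

/-- The signed sum over the labelled diagrams, grouped by arc diagrams. -/
theorem sum_labeledDiagram_elemFun (G : SimpleGraph (Fin n)) :
    ∑ D : LabeledDiagram G, (-1 : ℚ) ^ D.numTics • elemFun D.partition =
      (n.factorial : ℚ) • ∑ A : ArcDiagram G, ∏ C ∈ A.components.parts, cutSum C := by
  classical
  ext κ
  simp only [Finset.sum_apply, Pi.smul_apply, Finset.prod_apply, smul_eq_mul]
  calc ∑ D : LabeledDiagram G, (-1 : ℚ) ^ D.numTics * elemFun D.partition κ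
      = ∑ x : Σ D : TicDiagram G, D.Labels × D.Stars,
          (-1 : ℚ) ^ x.1.numTics * elemFun x.1.partition κ :=
        Fintype.sum_equiv (labeledDiagramEquiv G) _ _ fun _ => rfl
    _ = ∑ D : TicDiagram G, n.factorial * ((-1 : ℚ) ^ D.numTics *
          ∏ C ∈ D.components.parts, cutTerm C (D.cuts ∩ nonMin C) κ) := by
        rw [Fintype.sum_sigma]
        refine Finset.sum_congr rfl fun D _ => ?_
        dsimp only
        rw [Finset.sum_const, Finset.card_univ, ← Nat.card_eq_fintype_card, nsmul_eq_mul,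
          mul_left_comm, D.card_labels_mul_card_stars_mul_elemFun]
        ring
    _ = ∑ x : Σ A : ArcDiagram G, A.arcs.powerset, n.factorial * ((-1 : ℚ) ^ x.2.1.card *
          ∏ C ∈ x.1.components.parts, cutTerm C (x.2.1.image Prod.snd ∩ nonMin C) κ) :=
        Fintype.sum_equiv (ticDiagramEquiv G) _ _ fun _ => rfl
    _ = n.factorial * ∑ A : ArcDiagram G, ∏ C ∈ A.components.parts, cutSum C κ := by
        rw [Fintype.sum_sigma, Finset.mul_sum]
        refine Finset.sum_congr rfl fun A _ => ?_
        rw [← Finset.mul_sum, ← sum_powerset_cuts]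
        congr 1
        exact Finset.sum_coe_sort A.arcs.powerset fun T => (-1 : ℚ) ^ T.card *
          ∏ C ∈ A.components.parts, cutTerm C (T.image Prod.snd ∩ nonMin C) κ

end NCChrom

theorem mainTheorem2 (n : ℕ) (G : SimpleGraph (Fin n)) (hG : NCChrom.IsUnitInterval G) :
    NCChrom.SemiEquiv n (NCChrom.chromY G)
      ((1 / (n.factorial : ℚ)) •
        ∑ D : NCChrom.LabeledDiagram G,
          (-1 : ℚ) ^ D.numTics • NCChrom.elem D.partition) := by
  open NCChrom in
  have hR : (1 / (n.factorial : ℚ)) •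
      ∑ D : LabeledDiagram G, (-1 : ℚ) ^ D.numTics • elem D.partition =
      toSeries n ((1 / (n.factorial : ℚ)) •
        ∑ D : LabeledDiagram G, (-1 : ℚ) ^ D.numTics • elemFun D.partition) := by
    simp only [map_smul, map_sum, elem_eq_toSeries]
  rw [hR, NCChrom.chromY_eq_toSeries hG]
  refine NCChrom.semiEquiv_toSeries ?_ ?_ ?_
  · refine Submodule.sum_mem _ fun A _ => ?_
    have : ∏ C ∈ A.components.parts, NCChrom.signedConst (K := ℕ+) C =
        (∏ C ∈ A.components.parts, (-1 : ℚ) ^ (C.card - 1)) • NCChrom.powFun A.components := by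
      ext κ
      simp [NCChrom.signedConst, NCChrom.powFun, Finset.prod_mul_distrib]
    rw [this]
    exact Submodule.smul_mem _ _ (NCChrom.powFun_mem_span _)
  · exact Submodule.smul_mem _ _ (Submodule.sum_mem _ fun D _ =>
      Submodule.smul_mem _ _ (Submodule.subset_span ⟨_, rfl⟩))
  -- Both sides are now sums over the same arc diagrams and are compared term by term, with F = 1 in
  -- `symmetrize_prod_cutSum`.
  · have hn : (n.factorial : ℚ) ≠ 0 := by exact_mod_cast n.factorial_ne_zero
    rw [NCChrom.sum_labeledDiagram_elemFun, smul_smul, one_div, inv_mul_cancel₀ hn, one_smul,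
      map_sum, map_sum]
    refine Finset.sum_congr rfl fun A _ => ?_
    have := NCChrom.symmetrize_prod_cutSum A.components.parts
      (fun C hC => A.components.nonempty_of_mem_parts hC) A.components.disjoint 1
      (fun C _ κ κ' _ => rfl)
    rw [one_mul, one_mul] at this
    exact this.symm
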